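/- Let $L>0$ and $H=L^2(0,L)$ with its usual norm. Let $A:D(A)\subset H\to H$ be the operator $Az=-z'-z'''$ with domain $D(A)=\{z\in H^3(0,L)\mid z(0)=z(L)=z'(L)=0\}$, and let $\mathfrak{sat}(s)(x)=\max(-1,\min(1,s(x)))$ be the pointwise saturation, acting on $s\in H$. Consider the saturated linearized Korteweg--de Vries equation with disturbance $d\in L^2((0,\infty);H)$, $$ \begin{cases} z_t+z_x+z_{xxx}=-\mathfrak{sat}(z+d), & t\ge 0,\ x\in[0,L],\\ z(t,0)=z(t,L)=0,\quad z_x(t,L)=0, & t\ge 0,\\ z(0,x)=z_0(x), & x\in[0,L]. \end{cases} $$ Then $A$ generates a strongly continuous semigroup $(e^{tA})_{t\ge 0}$ of linear contractions on $H$; for all $z_0\in H$ and $d\in L^2((0,\infty);H)$ the equation has a weak solution on $[0,\infty)$, that is, a continuous $z:[0,\infty)\to H$ with $$z(t)=e^{tA}z_0-\int_0^t e^{(t-s)A}\,\mathfrak{sat}\big(z(s)+d(s)\big)\,ds,\qquad t\ge 0;$$ and the origin is input-to-state stable (ISS) with respect to $d$: there exist a class $\mathcal{KL}$ function $\alpha$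 and a class $\mathcal{K}_\infty$ function $\rho$ such that, for all $z_0\in H$, all $d\in L^2((0,\infty);H)$ and every weak solution $z$, $$\|z(t)\|_{H}\le \alpha(\|z_0\|_{H},t)+\rho\big(\|d\|_{L^2((0,\infty);H)}\big),\qquad t\ge 0.$$ Here $\rho:[0,\infty)\to[0,\infty)$ is of class $\mathcal K_\infty$ if it is continuous, strictly increasing, unbounded and $\rho(0)=0$; and $\alpha:[0,\infty)^2\to[0,\infty)$ is of class $\mathcal{KL}$ if it is continuous, for every $t\ge0$ the function $\alpha(\cdot,t)$ is strictly increasing with $\alpha(0,t)=0$, and for every $r>0$ the function $\alpha(r,\cdot)$ is strictly decreasing with limit $0$ at infinity. -/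

import Mathlib

open MeasureTheory Set Filter Topology
open scoped ContDiff

noncomputable section

namespace KdVISS

/-! ### Comparison functions -/

/-- Class `𝒦∞` functions on `[0, ∞)`. -/
structure IsClassKInfty (ρ : ℝ → ℝ) : Prop where
  continuousOn : ContinuousOn ρ (Ici 0)
  strictMonoOn : StrictMonoOn ρ (Ici 0)
  zero : ρ 0 = 0
  tendsto : Tendsto ρ atTop atTop

/-- Class `𝒦ℒ` functions on `[0, ∞) × [0, ∞)`: continuous, of class `𝒦` in the first variable,
and, for every `r > 0`, strictly decreasing to `0` in the second variable. -/
structure IsClassKL (α : ℝ → ℝ → ℝ) : Prop where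
  continuousOn : ContinuousOn (fun p : ℝ × ℝ => α p.1 p.2) (Ici 0 ×ˢ Ici 0)
  zero : ∀ t, 0 ≤ t → α 0 t = 0
  strictMonoOn : ∀ t, 0 ≤ t → StrictMonoOn (fun r => α r t) (Ici 0)
  strictAntiOn : ∀ r, 0 < r → StrictAntiOn (fun t => α r t) (Ici 0)
  tendsto : ∀ r, 0 < r → Tendsto (fun t => α r t) atTop (𝓝 0)

/-! ### Strongly continuous semigroups, weak solutions, input-to-state stability -/

section Abstract

variable {H : Type*} [NormedAddCommGroup H] [NormedSpace ℝ H]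

/-- A strongly continuous semigroup `(T t)_{t ≥ 0}` of linear contractions on `H`
(the values of `T` at negative times are irrelevant). -/
structure IsContractionSemigroup (T : ℝ → H →L[ℝ] H) : Prop where
  zero : T 0 = ContinuousLinearMap.id ℝ H
  add : ∀ s t, 0 ≤ s → 0 ≤ t → T (s + t) = (T s).comp (T t)
  continuousOn : ∀ x, ContinuousOn (fun t => T t x) (Ici 0)
  norm_le_one : ∀ t, 0 ≤ t → ‖T t‖ ≤ 1

/-- The unbounded operator with graph `{(x, y) | A x y}` is the infinitesimal generator of `T`:
`x` is in the domain and `y = A x` if and only if `(T h x - x) / h → y` as `h → 0⁺`. -/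
def IsGeneratorOf (A : H → H → Prop) (T : ℝ → H →L[ℝ] H) : Prop :=
  ∀ x y, A x y ↔ Tendsto (fun h : ℝ => h⁻¹ • (T h x - x)) (𝓝[>] 0) (𝓝 y)

/-- Disturbances: the space `L²((0, ∞); H)` with its usual norm. -/
abbrev Disturbance (H : Type*) [NormedAddCommGroup H] : Type _ :=
  Lp H 2 (volume.restrict (Ioi (0 : ℝ)))

/-- `z : [0, ∞) → H` is the weak (mild) solution of `dz/dt = A z - σ (z + d)`, `z 0 = z₀`, where
`A` generates `T`: it is continuous and satisfies the variation of constants formula. -/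
structure IsWeakSolution (T : ℝ → H →L[ℝ] H) (σ : H → H) (d : Disturbance H) (z₀ : H)
    (z : ℝ → H) : Prop where
  continuousOn : ContinuousOn z (Ici 0)
  intervalIntegrable : ∀ t, 0 ≤ t →
    IntervalIntegrable (fun s => T (t - s) (σ (z s + d s))) volume 0 t
  eq : ∀ t, 0 ≤ t → z t = T t z₀ - ∫ s in (0 : ℝ)..t, T (t - s) (σ (z s + d s))

/-- The origin of `dz/dt = A z - σ (z + d)` is input-to-state stable with respect to `d`. -/
def IsISS (T : ℝ → H →L[ℝ] H) (σ : H → H) : Prop :=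
  ∃ (α : ℝ → ℝ → ℝ) (ρ : ℝ → ℝ), IsClassKL α ∧ IsClassKInfty ρ ∧
    ∀ (z₀ : H) (d : Disturbance H) (z : ℝ → H), IsWeakSolution T σ d z₀ z →
      ∀ t, 0 ≤ t → ‖z t‖ ≤ α ‖z₀‖ t + ρ ‖d‖

end Abstract

/-! ### The state space and the saturation -/

/-- The real Hilbert space `L²(0, L)`. -/
abbrev L2 (L : ℝ) : Type := Lp ℝ 2 (volume.restrict (Ioo (0 : ℝ) L))

/-- The scalar saturation at level `1`. -/
def satReal (s : ℝ) : ℝ := if s ≤ -1 then -1 else if s ≤ 1 then s else 1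

theorem satReal_zero : satReal 0 = 0 := by
  norm_num [satReal]

theorem lipschitzWith_satReal : LipschitzWith 1 satReal := by
  refine LipschitzWith.of_dist_le_mul fun x y => ?_
  rw [NNReal.coe_one, one_mul, Real.dist_eq, Real.dist_eq, abs_le]
  have h1 := le_abs_self (x - y)
  have h2 := neg_abs_le (x - y)
  have h3 := abs_nonneg (x - y)
  unfold satReal
  split_ifs <;> constructor <;> linarith

/-- The pointwise saturation `s ↦ (x ↦ satReal (s x))`, acting on all of `L²(0, L)`. -/
def sat (L : ℝ) (s : L2 L) : L2 L :=
  lipschitzWith_satReal.compLp satReal_zero s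

theorem sat_coeFn (L : ℝ) (s : L2 L) :
    sat L s =ᵐ[volume.restrict (Ioo (0 : ℝ) L)] fun x => satReal (s x) :=
  lipschitzWith_satReal.coeFn_compLp satReal_zero s

/-! ### The linear Korteweg-de Vries operator -/

/-- `g ∈ L²(0, L)` is the weak derivative of `f ∈ L²(0, L)`. -/
def HasWeakDeriv (L : ℝ) (f g : L2 L) : Prop :=
  ∀ φ : ℝ → ℝ, ContDiff ℝ ∞ φ → HasCompactSupport φ → tsupport φ ⊆ Ioo 0 L →
    ∫ x in Ioo (0 : ℝ) L, f x * deriv φ x = -∫ x in Ioo (0 : ℝ) L, g x * φ x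

/-- `u` is a representative of `f ∈ L²(0, L)` that is continuous on `[0, L]`. -/
def IsContinuousRep (L : ℝ) (f : L2 L) (u : ℝ → ℝ) : Prop :=
  ContinuousOn u (Icc 0 L) ∧ f =ᵐ[volume.restrict (Ioo (0 : ℝ) L)] u

/-- The graph of `A z = - z' - z'''` with domain
`D(A) = {z ∈ H³(0, L) | z(0) = z(L) = z'(L) = 0}`: here `z₁, z₂, z₃ ∈ L²(0, L)` are the weak
derivatives of `z` up to order three, and the boundary values of `z` and `z'` are those of their
continuous representatives. -/
def KdVOperator (L : ℝ) (z w : L2 L) : Prop :=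
  ∃ z₁ z₂ z₃ : L2 L, HasWeakDeriv L z z₁ ∧ HasWeakDeriv L z₁ z₂ ∧ HasWeakDeriv L z₂ z₃ ∧
    (∃ u, IsContinuousRep L z u ∧ u 0 = 0 ∧ u L = 0) ∧
    (∃ u₁, IsContinuousRep L z₁ u₁ ∧ u₁ L = 0) ∧
    w = -z₁ - z₃

end KdVISS

end

open KdVISS

/-! Generation is the Lumer-Phillips argument. Integration by parts gives `⟨A z, z⟩ = -z'(0)² / 2 ≤
0`, and `l - A` is onto for every `l > 0` because the boundary value problem can be solved by
shooting from `x = L`. Such an operator is densely defined with `‖(l - A)⁻¹‖ ≤ 1 / l`, and the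
exponentials of its Yosida approximations converge to the semigroup. Since `sat` is 1-Lipschitz and
bounded by `√L` in `L²`, a Banach fixed point in an exponentially weighted sup norm yields global
weak solutions.

For stability, the energy estimate is `d/dt ‖z‖² ≤ -2 ⟨sat (z + d), z⟩ ≤ -⟨sat z, z⟩ + 16 ‖d‖²`,
hence `‖z(t)‖² ≤ ‖z₀‖² + 16 ‖d‖²` (`energy_le`, `norm_sq_le`). The saturated dissipation does not
control `‖z‖²` uniformly; pointwise, `a² ≤ (2 + a²) sat(a) a`, so `‖z‖² ≤ (2 + sup z²) ⟨sat z, z⟩`.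
The supremum is governed by Kato smoothing: with the multiplier `x z`, the integral of `‖z_x‖²` over
a time window of length one is bounded in terms of the energy. A Young inequality linear in `sup z²`
turns this into an observability estimate (`window_le`), and the energy contracts by `(Q + 1) / (Q +
2)` per unit of time, up to the disturbance, with `Q` affine in an a priori bound on `‖z‖²`
(`step_le`, `decay_le`). The rate thus depends on `‖z₀‖² + 16 ‖d‖²`. If `‖d‖ ≤ ‖z₀‖` it is bounded
below in terms of `‖z₀‖` alone; otherwise the a priori bound is already a multiple of `‖d‖`.

Weak solutions need not lie in `D(A)`. All identities are therefore proved for the regularization `y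
= l (l - A)⁻¹ z`, which takes values in `D(A)` and is Lipschitz in time on bounded intervals
(`mild_energy_identity`). The final bounds do not involve `‖A y‖`, so they survive `l → ∞`. -/

namespace KdVISS

/-! ### Hille-Yosida and Lumer-Phillips theory: resolvents and Yosida approximations. -/

section Generation

variable {H : Type*} [NormedAddCommGroup H] [InnerProductSpace ℝ H]

/-- `R l = (l - A)⁻¹` for all `l > 0`, with the contractivity bound `‖R l‖ ≤ 1 / l`, and `A` is
densely defined. -/
structure IsResolventOf (A : H → H → Prop) (R : ℝ → H →L[ℝ] H) : Prop where
  graph_iff : ∀ l, 0 < l → ∀ x y, A x y ↔ R l (l • x - y) = x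
  norm_le : ∀ l, 0 < l → ∀ x, ‖R l x‖ ≤ l⁻¹ * ‖x‖
  dense : Dense {x | ∃ y, A x y}

/-- The Yosida approximation `l (l R l - 1) = A (l R l)`. -/
noncomputable def yosida (R : ℝ → H →L[ℝ] H) (l : ℝ) : H →L[ℝ] H := l • (l • R l - 1)

theorem yosida_apply (R : ℝ → H →L[ℝ] H) (l : ℝ) (x : H) :
    yosida R l x = l • (l • R l x - x) := rfl

/-- The uniformly continuous semigroup generated by the Yosida approximation. -/
noncomputable def yosidaExp (R : ℝ → H →L[ℝ] H) (l t : ℝ) : H →L[ℝ] H :=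
  NormedSpace.exp (t • yosida R l)

namespace IsResolventOf

variable {A : H → H → Prop} {R : ℝ → H →L[ℝ] H}

theorem mem_graph (hR : IsResolventOf A R) {l : ℝ} (hl : 0 < l) (x : H) :
    A (R l x) (l • R l x - x) := by
  rw [hR.graph_iff l hl]
  simp

theorem smul_mem_graph (hR : IsResolventOf A R) {l : ℝ} (hl : 0 < l) (x : H) :
    A (l • R l x) (yosida R l x) := by
  rw [hR.graph_iff l hl, yosida_apply, ← smul_sub, map_smul]
  simp

theorem norm_smul_le (hR : IsResolventOf A R) {l : ℝ} (hl : 0 < l) (x : H) :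
    ‖l • R l x‖ ≤ ‖x‖ := by
  have h := hR.norm_le l hl x
  rw [norm_smul, Real.norm_of_nonneg hl.le]
  calc l * ‖R l x‖ ≤ l * (l⁻¹ * ‖x‖) := by gcongr
    _ = ‖x‖ := by field_simp

theorem yosida_eq (hR : IsResolventOf A R) {l : ℝ} (hl : 0 < l) {x y : H} (h : A x y) :
    yosida R l x = l • R l y := by
  have h1 := (hR.graph_iff l hl x y).1 h
  rw [map_sub, map_smul] at h1
  rw [yosida_apply]
  congr 1
  rw [sub_eq_iff_eq_add] at h1
  rw [h1]
  abel

theorem norm_smul_sub_le (hR : IsResolventOf A R) {l : ℝ} (hl : 0 < l) {x y : H} (h : A x y) :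
    ‖l • R l x - x‖ ≤ l⁻¹ * ‖y‖ := by
  have h1 := (hR.graph_iff l hl x y).1 h
  rw [map_sub, map_smul, sub_eq_iff_eq_add] at h1
  have : l • R l x - x = R l y := by rw [h1]; abel
  rw [this]
  exact hR.norm_le l hl y

theorem exists_near (hR : IsResolventOf A R) (x : H) {ε : ℝ} (hε : 0 < ε) :
    ∃ x' y', A x' y' ∧ ‖x - x'‖ < ε := by
  obtain ⟨x', ⟨y, hy⟩, hx'⟩ := hR.dense.exists_dist_lt x hε
  exact ⟨x', y, hy, by rwa [← dist_eq_norm]⟩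

/-- On the domain the error is `R l (A x)`, of size `‖A x‖ / l`; density and the uniform bound `‖l R
l‖ ≤ 1` extend the convergence to all of `H`. -/
theorem tendsto_smul (hR : IsResolventOf A R) (x : H) :
    Tendsto (fun l => l • R l x) atTop (𝓝 x) := by
  rw [Metric.tendsto_nhds]
  intro ε hε
  obtain ⟨x', y, hy, hx'⟩ := hR.exists_near x (ε := ε / 3) (by positivity)
  have h0 : Tendsto (fun l : ℝ => l⁻¹ * ‖y‖) atTop (𝓝 0) := by
    simpa using tendsto_inv_atTop_zero.mul_const ‖y‖
  filter_upwards [h0.eventually_lt_const (show (0 : ℝ) < ε / 3 by positivity),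
    eventually_gt_atTop 0] with l hl hl0
  rw [dist_eq_norm]
  have e : l • R l x - x = l • R l (x - x') + (l • R l x' - x') + (x' - x) := by
    rw [map_sub, smul_sub]; abel
  rw [e]
  have h1 := hR.norm_smul_le hl0 (x - x')
  have h2 := hR.norm_smul_sub_le hl0 hy
  rw [← norm_neg, neg_sub] at hx'
  have h3 : ‖x - x'‖ = ‖x' - x‖ := norm_sub_rev _ _
  linarith [norm_add₃_le (a := l • R l (x - x')) (b := l • R l x' - x') (c := x' - x)]

theorem tendsto_yosida (hR : IsResolventOf A R) {x y : H} (h : A x y) :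
    Tendsto (fun l => yosida R l x) atTop (𝓝 y) := by
  refine (hR.tendsto_smul y).congr' ?_
  filter_upwards [eventually_gt_atTop 0] with l hl
  exact (hR.yosida_eq hl h).symm

/-- The resolvent identity `R m = R l + (l - m) R l R m`, compared with the one obtained by
exchanging `l` and `m`. -/
theorem resolvent_comm (hR : IsResolventOf A R) {l m : ℝ} (hl : 0 < l) (hm : 0 < m) (x : H) :
    R l (R m x) = R m (R l x) := by
  rcases eq_or_ne l m with rfl | hlm
  · rfl
  have key : ∀ {l m : ℝ}, 0 < l → 0 < m → R m x = R l x + (l - m) • R l (R m x) := by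
    intro l m hl hm
    have h1 := (hR.graph_iff l hl _ _).1 (hR.mem_graph hm x)
    rw [← sub_add, ← sub_smul, map_add, map_smul] at h1
    rw [add_comm, h1]
  have h1 := key hl hm
  have h2 := key hm hl
  rw [h2, add_assoc, left_eq_add, ← neg_sub l m, neg_smul, neg_add_eq_zero] at h1
  exact (smul_right_injective H (sub_ne_zero.2 hlm) h1).symm

theorem yosida_commute (hR : IsResolventOf A R) {l m : ℝ} (hl : 0 < l) (hm : 0 < m) :
    Commute (yosida R l) (yosida R m) := by
  have h : Commute (R l) (R m) := by
    ext x
    exact hR.resolvent_comm hl hm x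
  have h2 : Commute (l • R l - 1) (m • R m - 1) := by
    refine Commute.sub_left (Commute.sub_right ?_ ?_) (Commute.one_left _)
    · exact (h.smul_left l).smul_right m
    · exact Commute.one_right _
  exact (h2.smul_left l).smul_right m

theorem resolvent_commute_yosida (hR : IsResolventOf A R) {l m : ℝ} (hl : 0 < l) (hm : 0 < m) :
    Commute (R l) (yosida R m) := by
  have h : Commute (R l) (R m) := by
    ext x
    exact hR.resolvent_comm hl hm x
  exact ((h.smul_right m).sub_right (Commute.one_right _)).smul_right m

/-- Cauchy-Schwarz and `‖l R l x‖ ≤ ‖x‖`. This dissipativity makes the exponentials of the Yosida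
approximations contractions. -/
theorem inner_yosida_nonpos (hR : IsResolventOf A R) {l : ℝ} (hl : 0 < l) (x : H) :
    inner ℝ (yosida R l x) x ≤ 0 := by
  rw [yosida_apply, inner_smul_left, inner_sub_left, real_inner_self_eq_norm_sq]
  have h1 := real_inner_le_norm (l • R l x) x
  have h2 := hR.norm_smul_le hl x
  have h3 : ‖l • R l x‖ * ‖x‖ ≤ ‖x‖ * ‖x‖ := by gcongr
  have : inner ℝ (l • R l x) x - ‖x‖ ^ 2 ≤ 0 := by nlinarith
  simpa using mul_nonpos_of_nonneg_of_nonpos hl.le this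

end IsResolventOf

/-! ### Exponentials of the Yosida approximations and their limit. -/

variable [CompleteSpace H] (R : ℝ → H →L[ℝ] H)

omit [CompleteSpace H] in
theorem yosidaExp_zero (l : ℝ) : yosidaExp R l 0 = 1 := by
  simp [yosidaExp]

theorem yosidaExp_add (l s t : ℝ) :
    yosidaExp R l (s + t) = yosidaExp R l s * yosidaExp R l t := by
  rw [yosidaExp, add_smul]
  let : NormedAlgebra ℚ (H →L[ℝ] H) := .restrictScalars ℚ ℝ _
  exact NormedSpace.exp_add_of_commute (((Commute.refl _).smul_left s).smul_right t)

theorem hasDerivAt_yosidaExp (l t : ℝ) (x : H) :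
    HasDerivAt (fun s => yosidaExp R l s x) (yosida R l (yosidaExp R l t x)) t := by
  have h := hasDerivAt_exp_smul_const' (𝕂 := ℝ) (yosida R l) t
  exact (h.clm_apply (hasDerivAt_const t x)).congr_deriv (by simp [yosidaExp])

variable {R}

omit [CompleteSpace H] in
theorem commute_yosidaExp {S : H →L[ℝ] H} {l : ℝ} (h : Commute S (yosida R l)) (t : ℝ) :
    Commute S (yosidaExp R l t) := by
  exact (h.smul_right t).exp_right

namespace IsResolventOf

variable {A : H → H → Prop}

theorem norm_yosidaExp_le (hR : IsResolventOf A R) {l : ℝ} (hl : 0 < l) {t : ℝ} (ht : 0 ≤ t)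
    (x : H) : ‖yosidaExp R l t x‖ ≤ ‖x‖ := by
  have hd : ∀ s, HasDerivAt (fun s => ‖yosidaExp R l s x‖ ^ 2)
      (2 * inner ℝ (yosidaExp R l s x) (yosida R l (yosidaExp R l s x))) s := fun s =>
    (hasDerivAt_yosidaExp R l s x).norm_sq
  have ha : Antitone (fun s => ‖yosidaExp R l s x‖ ^ 2) := by
    refine antitone_of_deriv_nonpos (fun s => (hd s).differentiableAt) fun s => ?_
    rw [(hd s).deriv, real_inner_comm]
    linarith [hR.inner_yosida_nonpos hl (yosidaExp R l s x)]
  have h := ha ht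
  simp only [yosidaExp_zero, one_apply_eq_self] at h
  exact (sq_le_sq₀ (norm_nonneg _) (norm_nonneg _)).1 h

/-- Interpolate by `s ↦ exp(s A_l) exp((t - s) A_m) x`. Everything commutes, so the derivative is a
product of contractions applied to `(A_l - A_m) x`. -/
theorem norm_yosidaExp_sub_le (hR : IsResolventOf A R) {l m : ℝ} (hl : 0 < l) (hm : 0 < m)
    {t : ℝ} (ht : 0 ≤ t) (x : H) :
    ‖yosidaExp R l t x - yosidaExp R m t x‖ ≤ t * ‖yosida R l x - yosida R m x‖ := by
  have hc : ∀ s, Commute (yosida R l - yosida R m) (yosidaExp R m s) := fun s =>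
    (commute_yosidaExp (hR.yosida_commute hl hm) s).sub_left
      (commute_yosidaExp (Commute.refl _) s)
  have hd : ∀ s, HasDerivAt (fun s => yosidaExp R l s (yosidaExp R m (t - s) x))
      (yosidaExp R l s (yosidaExp R m (t - s) ((yosida R l - yosida R m) x))) s := by
    intro s
    have h1 := hasDerivAt_exp_smul_const (𝕂 := ℝ) (yosida R l) s
    have h2 : HasDerivAt (fun s => yosidaExp R m (t - s) x)
        (-(yosida R m (yosidaExp R m (t - s) x))) s := by
      have := (hasDerivAt_yosidaExp R m (t - s) x).scomp s ((hasDerivAt_id s).const_sub t)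
      rw [neg_one_smul] at this
      exact this
    have h3 := h1.clm_apply h2
    refine h3.congr_deriv ?_
    have := congrArg (fun S : H →L[ℝ] H => S x) (hc (t - s)).eq
    simp only [mul_apply_eq_comp] at this ⊢
    rw [← this]
    simp [yosidaExp, sub_eq_add_neg]
  have h := norm_image_sub_le_of_norm_deriv_le_segment' (a := 0) (b := t)
    (C := ‖(yosida R l - yosida R m) x‖) (fun s _ => (hd s).hasDerivWithinAt) (fun s hs =>
      (hR.norm_yosidaExp_le hl hs.1 _).trans
        (hR.norm_yosidaExp_le hm (sub_nonneg.2 hs.2.le) _)) t ⟨ht, le_rfl⟩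
  simp only [sub_self, sub_zero, yosidaExp_zero, one_apply_eq_self] at h
  rw [mul_comm]
  exact h

theorem norm_yosidaExp_sub_self_le (hR : IsResolventOf A R) {l : ℝ} (hl : 0 < l)
    {t : ℝ} (ht : 0 ≤ t) (x : H) : ‖yosidaExp R l t x - x‖ ≤ t * ‖yosida R l x‖ := by
  have h := norm_image_sub_le_of_norm_deriv_le_segment' (a := 0) (b := t)
    (C := ‖yosida R l x‖) (fun s _ => (hasDerivAt_yosidaExp R l s x).hasDerivWithinAt)
    (fun s hs => by
      have := congrArg (fun S : H →L[ℝ] H => S x)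
        (commute_yosidaExp (Commute.refl (yosida R l)) s).eq
      simp only [mul_apply_eq_comp] at this
      rw [this]
      exact hR.norm_yosidaExp_le hl hs.1 _) t ⟨ht, le_rfl⟩
  simp only [sub_zero, yosidaExp_zero, one_apply_eq_self] at h
  rw [mul_comm]
  exact h

/-- A first-order remainder that does not require `x ∈ D(A²)`: `y` stands for an element of the
domain close to `A x`, and only `A_l y` has to stay bounded as `l → ∞`. -/
theorem norm_yosidaExp_taylor_le (hR : IsResolventOf A R) {l : ℝ} (hl : 0 < l)
    {t : ℝ} (ht : 0 ≤ t) (x y : H) :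
    ‖yosidaExp R l t x - x - t • yosida R l x‖ ≤
      t * (2 * ‖yosida R l x - y‖ + t * ‖yosida R l y‖) := by
  have hd : ∀ s, HasDerivAt (fun s => yosidaExp R l s x - s • yosida R l x)
      (yosidaExp R l s (yosida R l x) - yosida R l x) s := by
    intro s
    refine ((hasDerivAt_yosidaExp R l s x).sub
      ((hasDerivAt_id s).smul_const (yosida R l x))).congr_deriv ?_
    have := congrArg (fun S : H →L[ℝ] H => S x)
      (commute_yosidaExp (Commute.refl (yosida R l)) s).eq
    simp only [mul_apply_eq_comp] at this
    rw [this, one_smul]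
  have h := norm_image_sub_le_of_norm_deriv_le_segment' (a := 0) (b := t)
    (C := 2 * ‖yosida R l x - y‖ + t * ‖yosida R l y‖)
    (fun s _ => (hd s).hasDerivWithinAt)
    (fun s hs => by
      have h1 := hR.norm_yosidaExp_le hl hs.1 (yosida R l x - y)
      have h2 := hR.norm_yosidaExp_sub_self_le hl hs.1 y
      have h3 : s * ‖yosida R l y‖ ≤ t * ‖yosida R l y‖ := by
        have := hs.2.le
        gcongr
      have e : yosidaExp R l s (yosida R l x) - yosida R l x =
          yosidaExp R l s (yosida R l x - y) + (yosidaExp R l s y - y) + (y - yosida R l x) := by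
        rw [map_sub]; abel
      rw [e]
      have h4 : ‖y - yosida R l x‖ = ‖yosida R l x - y‖ := norm_sub_rev _ _
      linarith [norm_add₃_le (a := yosidaExp R l s (yosida R l x - y))
        (b := yosidaExp R l s y - y) (c := y - yosida R l x)]) t ⟨ht, le_rfl⟩
  simp only [sub_zero, yosidaExp_zero, one_apply_eq_self, zero_smul] at h
  rw [mul_comm]
  convert h using 2
  abel

theorem cauchySeq_yosidaExp (hR : IsResolventOf A R) {t : ℝ} (ht : 0 ≤ t) (x : H) :
    CauchySeq (fun l => yosidaExp R l t x) := by
  rw [Metric.cauchySeq_iff]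
  intro ε hε
  obtain ⟨x', y, hy, hx'⟩ := hR.exists_near x (ε := ε / 3) (by positivity)
  have hc := (hR.tendsto_yosida hy).cauchySeq
  obtain ⟨N, hN⟩ := Metric.cauchySeq_iff.1 hc (ε / 3 / (t + 1)) (by positivity)
  refine ⟨max N 1, fun l hl m hm => ?_⟩
  have hl0 : 0 < l := by linarith [le_max_right N 1, show l ≥ max N 1 from hl]
  have hm0 : 0 < m := by linarith [le_max_right N 1, show m ≥ max N 1 from hm]
  have h1 := hN l (le_of_max_le_left hl) m (le_of_max_le_left hm)
  rw [dist_eq_norm] at h1 ⊢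
  have e : yosidaExp R l t x - yosidaExp R m t x = yosidaExp R l t (x - x') +
      (yosidaExp R l t x' - yosidaExp R m t x') + -(yosidaExp R m t (x - x')) := by
    rw [map_sub, map_sub]; abel
  rw [e]
  have h2 := hR.norm_yosidaExp_le hl0 ht (x - x')
  have h3 := hR.norm_yosidaExp_le hm0 ht (x - x')
  have h4 := hR.norm_yosidaExp_sub_le hl0 hm0 ht x'
  have h5 : t * ‖yosida R l x' - yosida R m x'‖ ≤ ε / 3 := by
    rw [lt_div_iff₀ (by positivity)] at h1
    nlinarith [norm_nonneg (yosida R l x' - yosida R m x')]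
  have h6 := norm_neg (yosidaExp R m t (x - x'))
  linarith [norm_add₃_le (a := yosidaExp R l t (x - x'))
    (b := yosidaExp R l t x' - yosidaExp R m t x') (c := -(yosidaExp R m t (x - x')))]

/-- **Hille-Yosida**: the limit of the semigroups generated by the Yosida approximations. -/
theorem exists_semigroup (hR : IsResolventOf A R) :
    ∃ T : ℝ → H →L[ℝ] H, ∀ t, 0 ≤ t → ∀ x,
      Tendsto (fun l => yosidaExp R l t x) atTop (𝓝 (T t x)) := by
  have h : ∀ t : ℝ, ∃ S : H →L[ℝ] H, 0 ≤ t → ∀ x,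
      Tendsto (fun l => yosidaExp R l t x) atTop (𝓝 (S x)) := by
    intro t
    by_cases ht : 0 ≤ t
    · choose f hf using fun x => cauchySeq_tendsto_of_complete (hR.cauchySeq_yosidaExp ht x)
      refine ⟨LinearMap.mkContinuous ⟨⟨f, fun x y => ?_⟩, fun c x => ?_⟩ 1 fun x => ?_,
        fun _ x => hf x⟩
      · refine tendsto_nhds_unique (hf (x + y)) ?_
        simpa using (hf x).add (hf y)
      · refine tendsto_nhds_unique (hf (c • x)) ?_
        simpa using (hf x).const_smul c
      · rw [one_mul]
        refine le_of_tendsto (hf x).norm ?_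
        filter_upwards [eventually_gt_atTop 0] with l hl
        exact hR.norm_yosidaExp_le hl ht x
    · exact ⟨0, fun h => absurd h ht⟩
  choose T hT using h
  exact ⟨T, fun t ht x => hT t ht x⟩

variable {T : ℝ → H →L[ℝ] H}

section Limit

variable (hR : IsResolventOf A R)
  (hT : ∀ t, 0 ≤ t → ∀ x, Tendsto (fun l => yosidaExp R l t x) atTop (𝓝 (T t x)))
include hR hT

theorem norm_limit_le {t : ℝ} (ht : 0 ≤ t) (x : H) : ‖T t x‖ ≤ ‖x‖ := by
  refine le_of_tendsto (hT t ht x).norm ?_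
  filter_upwards [eventually_gt_atTop 0] with l hl
  exact hR.norm_yosidaExp_le hl ht x

omit hR [CompleteSpace H] in
theorem limit_zero (x : H) : T 0 x = x := by
  refine tendsto_nhds_unique (hT 0 le_rfl x) ?_
  simp [yosidaExp_zero]

/-- Strong limits pass through the product because the approximating exponentials are uniformly
contractive. -/
theorem limit_add {s t : ℝ} (hs : 0 ≤ s) (ht : 0 ≤ t) (x : H) : T (s + t) x = T s (T t x) := by
  refine tendsto_nhds_unique (hT (s + t) (add_nonneg hs ht) x) ?_
  have h1 : Tendsto (fun l => yosidaExp R l s (yosidaExp R l t x - T t x)) atTop (𝓝 0) := by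
    refine squeeze_zero_norm' ?_ (tendsto_iff_norm_sub_tendsto_zero.1 (hT t ht x))
    filter_upwards [eventually_gt_atTop 0] with l hl
    exact hR.norm_yosidaExp_le hl hs _
  have h2 := h1.add (hT s hs (T t x))
  rw [zero_add] at h2
  refine h2.congr fun l => ?_
  rw [yosidaExp_add, map_sub, sub_add_cancel]
  rfl

theorem norm_limit_sub_self_le {x y : H} (h : A x y) {t : ℝ} (ht : 0 ≤ t) :
    ‖T t x - x‖ ≤ t * ‖y‖ := by
  refine le_of_tendsto_of_tendsto ((hT t ht x).sub_const x).norm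
    ((hR.tendsto_yosida h).norm.const_mul t) ?_
  filter_upwards [eventually_gt_atTop 0] with l hl
  exact hR.norm_yosidaExp_sub_self_le hl ht x

theorem norm_limit_taylor_le {x y x' y' : H} (h : A x y) (h' : A x' y') {t : ℝ} (ht : 0 ≤ t) :
    ‖T t x - x - t • y‖ ≤ t * (2 * ‖y - x'‖ + t * ‖y'‖) := by
  refine le_of_tendsto_of_tendsto
    (((hT t ht x).sub_const x).sub ((hR.tendsto_yosida h).const_smul t)).norm
    (((((hR.tendsto_yosida h).sub_const x').norm.const_mul 2).add
      ((hR.tendsto_yosida h').norm.const_mul t)).const_mul t) ?_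
  filter_upwards [eventually_gt_atTop 0] with l hl
  exact hR.norm_yosidaExp_taylor_le hl ht x x'

omit [CompleteSpace H] in
theorem limit_comm {l t : ℝ} (hl : 0 < l) (ht : 0 ≤ t) (x : H) :
    R l (T t x) = T t (R l x) := by
  refine tendsto_nhds_unique ?_ (hT t ht (R l x))
  refine (((R l).continuous.tendsto _).comp (hT t ht x)).congr' ?_
  filter_upwards [eventually_gt_atTop 0] with m hm
  exact congrArg (fun S : H →L[ℝ] H => S x)
    (commute_yosidaExp (hR.resolvent_commute_yosida hl hm) t).eq

theorem limit_hasDeriv {x y : H} (h : A x y) :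
    Tendsto (fun t : ℝ => t⁻¹ • (T t x - x)) (𝓝[>] 0) (𝓝 y) := by
  rw [Metric.tendsto_nhds]
  intro ε hε
  obtain ⟨x', y', hy, hx'⟩ := hR.exists_near y (ε := ε / 3) (by positivity)
  have h0 : Tendsto (fun t : ℝ => t * ‖y'‖) (𝓝[>] 0) (𝓝 0) := by
    have : Tendsto (fun t : ℝ => t * ‖y'‖) (𝓝 0) (𝓝 (0 * ‖y'‖)) :=
      tendsto_id.mul_const _
    rw [zero_mul] at this
    exact this.mono_left nhdsWithin_le_nhds
  filter_upwards [h0.eventually_lt_const (show (0 : ℝ) < ε / 3 by positivity),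
    self_mem_nhdsWithin] with t ht ht0
  have ht0 : 0 < t := ht0
  have h1 := norm_limit_taylor_le hR hT h hy ht0.le
  rw [dist_eq_norm]
  have e : t⁻¹ • (T t x - x) - y = t⁻¹ • (T t x - x - t • y) := by
    rw [smul_sub t⁻¹ (T t x - x), smul_smul, inv_mul_cancel₀ ht0.ne', one_smul]
  rw [e, norm_smul, Real.norm_of_nonneg (by positivity)]
  calc t⁻¹ * ‖T t x - x - t • y‖ ≤ t⁻¹ * (t * (2 * ‖y - x'‖ + t * ‖y'‖)) := by gcongr
    _ = 2 * ‖y - x'‖ + t * ‖y'‖ := by field_simp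
    _ < ε := by linarith

theorem limit_isContractionSemigroup : IsContractionSemigroup T where
  zero := by
    ext x
    exact limit_zero hT x
  add s t hs ht := by
    ext x
    exact limit_add hR hT hs ht x
  norm_le_one t ht := ContinuousLinearMap.opNorm_le_bound _ zero_le_one fun x => by
    rw [one_mul]
    exact norm_limit_le hR hT ht x
  continuousOn x := by
    have key : ∀ ε > 0, ∃ δ > 0, ∀ h, 0 ≤ h → h < δ → ‖T h x - x‖ < ε := by
      intro ε hε
      obtain ⟨x', y, hy, hx'⟩ := hR.exists_near x (ε := ε / 3) (by positivity)
      refine ⟨ε / 3 / (‖y‖ + 1), by positivity, fun h h0 hδ => ?_⟩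
      have h1 := norm_limit_sub_self_le hR hT hy h0
      have h2 := norm_limit_le hR hT h0 (x - x')
      rw [lt_div_iff₀ (by positivity)] at hδ
      have e : T h x - x = T h (x - x') + (T h x' - x') + -(x - x') := by
        rw [map_sub]; abel
      rw [e]
      have h6 := norm_neg (x - x')
      nlinarith [norm_add₃_le (a := T h (x - x')) (b := T h x' - x') (c := -(x - x')),
        norm_nonneg y]
    have key2 : ∀ s t, 0 ≤ s → s ≤ t → ‖T t x - T s x‖ ≤ ‖T (t - s) x - x‖ := by
      intro s t hs hst
      have : T t x = T s (T (t - s) x) := by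
        rw [← limit_add hR hT hs (sub_nonneg.2 hst), add_sub_cancel]
      rw [this, ← map_sub]
      exact norm_limit_le hR hT hs _
    rw [Metric.continuousOn_iff]
    intro t ht ε hε
    obtain ⟨δ, hδ, h⟩ := key ε hε
    refine ⟨δ, hδ, fun s hs hst => ?_⟩
    rw [Real.dist_eq, abs_lt] at hst
    rcases le_total s t with h1 | h1
    · rw [dist_comm, dist_eq_norm]
      exact (key2 s t hs h1).trans_lt (h _ (by linarith) (by linarith))
    · rw [dist_eq_norm]
      exact (key2 t s ht h1).trans_lt (h _ (by linarith) (by linarith))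

/-- The generator extends `A`, and maximality excludes a proper extension: if `(x, y)` is in its
graph and `x' = R 1 (x - y)`, then `x - x'` is mapped to itself, while contractivity of `T` makes
the generator dissipative, so `‖x - x'‖² ≤ 0`. -/
theorem limit_isGeneratorOf : IsGeneratorOf A T := by
  refine fun x y => ⟨limit_hasDeriv hR hT, fun h => ?_⟩
  rw [hR.graph_iff 1 one_pos, one_smul]
  set x' := R 1 (x - y) with hx'
  have hA := hR.mem_graph one_pos (x - y)
  rw [one_smul, ← hx'] at hA
  have h1 := h.sub (limit_hasDeriv hR hT hA)
  have e : y - (x' - (x - y)) = x - x' := by abel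
  rw [e] at h1
  have h2 : Tendsto (fun t : ℝ => inner ℝ (t⁻¹ • (T t (x - x') - (x - x'))) (x - x'))
      (𝓝[>] 0) (𝓝 (inner ℝ (x - x') (x - x'))) := by
    refine Tendsto.inner (h1.congr fun t => ?_) tendsto_const_nhds
    rw [← smul_sub, map_sub]
    congr 1
    abel
  have h3 : inner ℝ (x - x') (x - x') ≤ 0 := by
    refine le_of_tendsto h2 ?_
    filter_upwards [self_mem_nhdsWithin] with t ht
    have ht : 0 < t := ht
    rw [inner_smul_left, inner_sub_left, real_inner_self_eq_norm_sq]
    have h4 := real_inner_le_norm (T t (x - x')) (x - x')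
    have h5 : ‖T t (x - x')‖ * ‖x - x'‖ ≤ ‖x - x'‖ * ‖x - x'‖ := by
      gcongr
      exact norm_limit_le hR hT ht.le _
    refine mul_nonpos_of_nonneg_of_nonpos ?_ (by nlinarith)
    simp [ht.le]
  rw [real_inner_self_eq_norm_sq] at h3
  have h4 : ‖x - x'‖ = 0 := by nlinarith [norm_nonneg (x - x')]
  exact (sub_eq_zero.1 (norm_eq_zero.1 h4)).symm

end Limit

end IsResolventOf

/-- A maximal dissipative operator has a contractive resolvent and is densely defined. -/
theorem exists_isResolventOf {A : H → H → Prop}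
    (hadd : ∀ x y x' y', A x y → A x' y' → A (x + x') (y + y'))
    (hsmul : ∀ (c : ℝ) x y, A x y → A (c • x) (c • y))
    (hdiss : ∀ x y, A x y → inner ℝ y x ≤ 0)
    (hrange : ∀ l : ℝ, 0 < l → ∀ f, ∃ x y, A x y ∧ l • x - y = f)
    (hsingle : ∀ y, A 0 y → y = 0) : ∃ R : ℝ → H →L[ℝ] H, IsResolventOf A R := by
  -- Dissipativity gives `l ‖x‖² ≤ ⟨l x - y, x⟩`; uniqueness of the resolvent and its bound both
  -- follow.
  have hbound : ∀ l : ℝ, 0 < l → ∀ x y, A x y → ‖x‖ ≤ l⁻¹ * ‖l • x - y‖ := by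
    intro l hl x y h
    have h1 := hdiss x y h
    have h2 := real_inner_le_norm (l • x - y) x
    rw [inner_sub_left, inner_smul_left, real_inner_self_eq_norm_sq] at h2
    simp only [conj_trivial] at h2
    rw [inv_mul_eq_div, le_div_iff₀ hl]
    by_contra! hlt
    have hx : 0 < ‖x‖ := by
      by_contra! h0
      have : ‖x‖ = 0 := le_antisymm h0 (norm_nonneg _)
      rw [this] at hlt
      linarith [norm_nonneg (l • x - y)]
    nlinarith
  have huniq : ∀ l : ℝ, 0 < l → ∀ x y x' y', A x y → A x' y' → l • x - y = l • x' - y' →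
      x = x' := by
    intro l hl x y x' y' h h' e
    have h1 := hbound l hl _ _ (hadd _ _ _ _ h (hsmul (-1) _ _ h'))
    have e2 : l • (x + (-1 : ℝ) • x') - (y + (-1 : ℝ) • y') = 0 := by
      have : l • (x + (-1 : ℝ) • x') - (y + (-1 : ℝ) • y') = (l • x - y) - (l • x' - y') := by
        module
      rw [this, e, sub_self]
    rw [e2, norm_zero, mul_zero] at h1
    have := norm_le_zero_iff.1 h1
    rw [neg_one_smul, ← sub_eq_add_neg, sub_eq_zero] at this
    exact this
  choose! r w hA he using hrange
  have hval : ∀ l : ℝ, 0 < l → ∀ x y, A x y → r l (l • x - y) = x := fun l hl x y h =>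
    huniq l hl _ _ _ _ (hA l hl _) h (he l hl _)
  have hRex : ∀ l : ℝ, ∃ S : H →L[ℝ] H, 0 < l → ∀ f, S f = r l f := by
    intro l
    by_cases hl : 0 < l
    · refine ⟨LinearMap.mkContinuous ⟨⟨r l, fun f g => ?_⟩, fun c f => ?_⟩ l⁻¹ fun f => ?_,
        fun _ f => rfl⟩
      · rw [← hval l hl _ _ (hadd _ _ _ _ (hA l hl f) (hA l hl g))]
        congr 1
        nth_rw 1 [← he l hl f, ← he l hl g]
        module
      · rw [← hval l hl _ _ (hsmul _ _ _ (hA l hl f))]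
        have e : l • c • r l f - c • w l f = c • f := by
          conv_rhs => rw [← he l hl f]
          module
        exact congrArg (r l) e.symm
      · have := hbound l hl _ _ (hA l hl f)
        rwa [he l hl f] at this
    · exact ⟨0, fun h => absurd h hl⟩
  choose R hR using hRex
  refine ⟨R, fun l hl x y => ⟨fun h => ?_, fun h => ?_⟩, fun l hl x => ?_, ?_⟩
  · rw [hR l hl, hval l hl x y h]
  · rw [hR l hl] at h
    have h1 := hA l hl (l • x - y)
    have h2 := he l hl (l • x - y)
    rw [h] at h1 h2
    rwa [sub_right_inj.1 h2] at h1
  · rw [hR l hl]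
    have := hbound l hl _ _ (hA l hl x)
    rwa [he l hl x] at this
  · let D : Submodule ℝ H :=
      { carrier := {x | ∃ y, A x y}
        add_mem' := fun ⟨y, h⟩ ⟨y', h'⟩ => ⟨_, hadd _ _ _ _ h h'⟩
        zero_mem' := by
          have := hsmul 0 _ _ (hA 1 one_pos 0)
          rw [zero_smul] at this
          exact ⟨_, this⟩
        smul_mem' := fun c x ⟨y, h⟩ => ⟨_, hsmul c _ _ h⟩ }
    have hD : Dense (D : Set H) := by
      rw [Submodule.dense_iff_topologicalClosure_eq_top, Submodule.topologicalClosure_eq_top_iff,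
        Submodule.eq_bot_iff]
      -- If `f` is orthogonal to the domain, write `f = x - A x`. Then `0 = ⟨f, x⟩ ≥ ‖x‖²`, so `x =
      -- 0`, and `f = -A 0 = 0`.
      intro f hf
      have h1 := hA 1 one_pos f
      have h2 := he 1 one_pos f
      have h3 := (Submodule.mem_orthogonal' _ _).1 hf (r 1 f) ⟨_, h1⟩
      have h4 := hdiss _ _ h1
      nth_rw 1 [← h2] at h3
      rw [one_smul, inner_sub_left, real_inner_self_eq_norm_sq] at h3
      have h5 : ‖r 1 f‖ = 0 := by nlinarith [norm_nonneg (r 1 f)]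
      have h6 := norm_eq_zero.1 h5
      rw [h6] at h1
      rw [← h2, h6, hsingle _ h1]
      simp
    exact hD

end Generation
end KdVISS

namespace KdVISS

/-! ### Convolution with a contraction semigroup and existence of weak solutions. -/

section Mild

variable {H : Type*} [NormedAddCommGroup H] [NormedSpace ℝ H] {T : ℝ → H →L[ℝ] H}

omit [NormedSpace ℝ H] in
theorem intervalIntegrable_of_bounded {f : ℝ → H} {C : ℝ}
    (hf : AEStronglyMeasurable f (volume.restrict (Ioi 0))) (hC : ∀ s, ‖f s‖ ≤ C)
    {a b : ℝ} (ha : 0 ≤ a) (hab : a ≤ b) : IntervalIntegrable f volume a b := by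
  rw [intervalIntegrable_iff_integrableOn_Ioc_of_le hab]
  have h : Ioc a b ⊆ Ioi 0 := fun s hs => ha.trans_lt hs.1
  exact Integrable.of_bound (hf.mono_measure (Measure.restrict_mono h le_rfl)) C (ae_of_all _ hC)

namespace IsContractionSemigroup

theorem norm_apply_le (hT : IsContractionSemigroup T) {t : ℝ} (ht : 0 ≤ t) (x : H) :
    ‖T t x‖ ≤ ‖x‖ :=
  (T t).le_of_opNorm_le_of_le (hT.norm_le_one t ht) le_rfl |>.trans_eq (one_mul _)

theorem apply_zero (hT : IsContractionSemigroup T) (x : H) : T 0 x = x := by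
  rw [hT.zero]; rfl

theorem apply_add (hT : IsContractionSemigroup T) {s t : ℝ} (hs : 0 ≤ s) (ht : 0 ≤ t) (x : H) :
    T (s + t) x = T s (T t x) := by
  rw [hT.add s t hs ht]; rfl

/-- Strong continuity and the uniform bound give joint continuity. Times are clamped at `0` because
nothing is known about `T` at negative times. -/
theorem continuous_apply (hT : IsContractionSemigroup T) :
    Continuous fun p : ℝ × H => T (max p.1 0) p.2 := by
  rw [continuous_iff_continuousAt]
  rintro ⟨r, x⟩
  have h1 : Continuous fun s : ℝ => T (max s 0) x :=
    (hT.continuousOn x).comp_continuous (continuous_id.max continuous_const)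
      fun s => mem_Ici.2 (le_max_right _ _)
  have h2 : Tendsto (fun p : ℝ × H => T (max p.1 0) (p.2 - x)) (𝓝 (r, x)) (𝓝 0) := by
    refine squeeze_zero_norm (fun p => hT.norm_apply_le (le_max_right _ _) _) ?_
    have : Continuous fun p : ℝ × H => ‖p.2 - x‖ := by fun_prop
    simpa using this.tendsto (r, x)
  have h3 : Tendsto (fun p : ℝ × H => T (max p.1 0) x) (𝓝 (r, x)) (𝓝 (T (max r 0) x)) :=
    (h1.comp continuous_fst).tendsto (r, x)
  have h4 := h2.add h3
  rw [zero_add] at h4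
  refine h4.congr fun p => ?_
  rw [map_sub, sub_add_cancel]

variable {f : ℝ → H} {C : ℝ}

theorem aestronglyMeasurable (hT : IsContractionSemigroup T)
    {μ : Measure ℝ} (hf : AEStronglyMeasurable f μ) (t : ℝ) :
    AEStronglyMeasurable (fun s => T (max (t - s) 0) (f s)) μ := by
  have h : AEStronglyMeasurable (fun s => (t - s, f s)) μ :=
    (continuous_const.sub continuous_id).aestronglyMeasurable.prodMk hf
  exact hT.continuous_apply.comp_aestronglyMeasurable h

theorem intervalIntegrable (hT : IsContractionSemigroup T)
    (hf : AEStronglyMeasurable f (volume.restrict (Ioi 0))) (hC : ∀ s, ‖f s‖ ≤ C)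
    {a b t : ℝ} (ha : 0 ≤ a) (hab : a ≤ b) (hbt : b ≤ t) :
    IntervalIntegrable (fun s => T (t - s) (f s)) volume a b := by
  have h1 : AEStronglyMeasurable (fun s => T (max (t - s) 0) (f s)) (volume.restrict (Ioc a b)) :=
    hT.aestronglyMeasurable (hf.mono_measure
      (Measure.restrict_mono (fun s hs => ha.trans_lt hs.1) le_rfl)) t
  rw [intervalIntegrable_iff_integrableOn_Ioc_of_le hab]
  have h2 : IntegrableOn (fun s => T (max (t - s) 0) (f s)) (Ioc a b) volume :=
    Integrable.of_bound h1 C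
      (ae_of_all _ fun s => (hT.norm_apply_le (le_max_right _ _) _).trans (hC s))
  refine h2.congr_fun (fun s hs => ?_) measurableSet_Ioc
  simp only
  rw [max_eq_left (by linarith [hs.2])]

/-- Writing the moving endpoint as an indicator fixes the domain of integration. For each `s ≠ t₀`
the integrand is continuous at `t = t₀`, and dominated convergence applies. -/
theorem continuousOn_convolution (hT : IsContractionSemigroup T)
    (hf : AEStronglyMeasurable f (volume.restrict (Ioi 0))) (hC : ∀ s, ‖f s‖ ≤ C) :
    ContinuousOn (fun t => ∫ s in (0 : ℝ)..t, T (t - s) (f s)) (Ici 0) := by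
  have hC0 : 0 ≤ C := (norm_nonneg _).trans (hC 0)
  let F : ℝ → ℝ → H := fun t s => (Iic t).indicator (fun s => T (max (t - s) 0) (f s)) s
  have hcont : Continuous fun t => ∫ s in Ioi (0 : ℝ), F t s := by
    rw [continuous_iff_continuousAt]
    intro t₀
    refine continuousAt_of_dominated (bound := (Iic (t₀ + 1)).indicator fun _ => C) ?_ ?_ ?_ ?_
    · exact Eventually.of_forall fun t => (hT.aestronglyMeasurable hf t).indicator measurableSet_Iic
    · filter_upwards [gt_mem_nhds (lt_add_one t₀)] with t ht
      refine ae_of_all _ fun s => ?_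
      by_cases hs : s ≤ t
      · have hs' : s ≤ t₀ + 1 := hs.trans ht.le
        simp only [F, indicator_of_mem (show s ∈ Iic t from hs),
          indicator_of_mem (show s ∈ Iic (t₀ + 1) from hs')]
        exact (hT.norm_apply_le (le_max_right _ _) _).trans (hC s)
      · simp only [F, indicator_of_notMem (show s ∉ Iic t from hs), norm_zero]
        exact indicator_nonneg (fun _ _ => hC0) _
    · rw [integrable_indicator_iff measurableSet_Iic, IntegrableOn,
        Measure.restrict_restrict measurableSet_Iic]
      have : Iic (t₀ + 1) ∩ Ioi 0 = Ioc 0 (t₀ + 1) := by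
        ext s; simp [and_comm]
      rw [this]
      exact integrable_const C
    · have h1 : ∀ᵐ s ∂(volume.restrict (Ioi (0 : ℝ))), s ≠ t₀ := Measure.ae_ne _ _
      filter_upwards [h1] with s hs
      rcases lt_or_gt_of_ne hs with h | h
      · have hc : ContinuousAt (fun t => T (max (t - s) 0) (f s)) t₀ :=
          (hT.continuous_apply.comp
            ((continuous_id.sub continuous_const).prodMk continuous_const)).continuousAt
        refine hc.congr ?_
        filter_upwards [lt_mem_nhds h] with t ht
        simp only [F, indicator_of_mem (show s ∈ Iic t from ht.le)]
      · refine (continuousAt_const (y := (0 : H))).congr ?_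
        filter_upwards [gt_mem_nhds h] with t ht
        simp only [F, indicator_of_notMem (show s ∉ Iic t from not_le.2 ht)]
  refine hcont.continuousOn.congr fun t ht => ?_
  have ht : 0 ≤ t := ht
  have hIoc : Ioi (0 : ℝ) ∩ Iic t = Ioc 0 t := by ext s; simp
  simp only [F]
  rw [setIntegral_indicator measurableSet_Iic, hIoc, intervalIntegral.integral_of_le ht]
  refine setIntegral_congr_fun measurableSet_Ioc fun s hs => ?_
  rw [max_eq_left (by linarith [hs.2])]

theorem norm_convolution_le (hT : IsContractionSemigroup T) (hC : ∀ s, ‖f s‖ ≤ C)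
    {t : ℝ} (ht : 0 ≤ t) : ‖∫ s in (0 : ℝ)..t, T (t - s) (f s)‖ ≤ C * t := by
  have h := intervalIntegral.norm_integral_le_of_norm_le_const (a := (0 : ℝ)) (b := t) (C := C)
    (f := fun s => T (t - s) (f s)) fun s hs => by
      rw [uIoc_of_le ht] at hs
      exact (hT.norm_apply_le (by linarith [hs.2]) _).trans (hC s)
  rwa [sub_zero, abs_of_nonneg ht] at h

theorem mild_restart [CompleteSpace H] (hT : IsContractionSemigroup T)
    (hf : AEStronglyMeasurable f (volume.restrict (Ioi 0))) (hC : ∀ s, ‖f s‖ ≤ C)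
    {z₀ : H} {z : ℝ → H}
    (hz : ∀ t, 0 ≤ t → z t = T t z₀ + ∫ s in (0 : ℝ)..t, T (t - s) (f s))
    {t τ : ℝ} (ht : 0 ≤ t) (hτ : t ≤ τ) :
    z τ = T (τ - t) (z t) + ∫ s in t..τ, T (τ - s) (f s) := by
  rw [hz t ht, hz τ (ht.trans hτ), map_add, ← hT.apply_add (sub_nonneg.2 hτ) ht, sub_add_cancel,
    ← ContinuousLinearMap.intervalIntegral_comp_comm _
      (hT.intervalIntegrable hf hC le_rfl ht le_rfl), add_assoc]
  congr 1
  rw [← intervalIntegral.integral_add_adjacent_intervals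
    (hT.intervalIntegrable hf hC le_rfl ht hτ) (hT.intervalIntegrable hf hC ht hτ le_rfl)]
  congr 1
  refine intervalIntegral.integral_congr fun s hs => ?_
  rw [uIcc_of_le ht] at hs
  rw [← hT.apply_add (sub_nonneg.2 hτ) (sub_nonneg.2 hs.2)]
  congr 2
  ring

end IsContractionSemigroup

open IsContractionSemigroup in
/-- Existence of weak solutions for a bounded nonexpansive feedback. -/
theorem exists_isWeakSolution [CompleteSpace H] (hT : IsContractionSemigroup T) {σ : H → H}
    (hσ : LipschitzWith 1 σ) {C : ℝ} (hC : ∀ x, ‖σ x‖ ≤ C) (d : Disturbance H) (z₀ : H) :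
    ∃ z, IsWeakSolution T σ d z₀ z := by
  have hC0 : 0 ≤ C := (norm_nonneg _).trans (hC 0)
  -- The unknown is `v(t) = e^{-2t} z(t)`. The weight keeps it bounded, since `z` grows at most
  -- linearly, and makes the fixed point map `1/2`-Lipschitz because `e^{-2r} ∫₀ʳ e^{2s} ds ≤ 1/2`.
  let f : BoundedContinuousFunction ℝ H → ℝ → H := fun v s => σ (Real.exp (2 * s) • v s + d s)
  have hfm : ∀ v, AEStronglyMeasurable (f v) (volume.restrict (Ioi 0)) := fun v =>
    hσ.continuous.comp_aestronglyMeasurable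
      (((by fun_prop : Continuous fun s : ℝ => Real.exp (2 * s) • v s).aestronglyMeasurable).add
        (Lp.aestronglyMeasurable d))
  have hfC : ∀ v s, ‖f v s‖ ≤ C := fun v s => hC _
  let U : BoundedContinuousFunction ℝ H → ℝ → H := fun v t =>
    T t z₀ - ∫ s in (0 : ℝ)..t, T (t - s) (f v s)
  have hU : ∀ v, ContinuousOn (U v) (Ici 0) := fun v =>
    (hT.continuousOn z₀).sub (hT.continuousOn_convolution (hfm v) (hfC v))
  let Φ : BoundedContinuousFunction ℝ H → BoundedContinuousFunction ℝ H := fun v =>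
    BoundedContinuousFunction.ofNormedAddCommGroup
      (fun t => Real.exp (-(2 * max t 0)) • U v (max t 0))
      (by
        have h1 : Continuous fun t : ℝ => max t 0 := continuous_id.max continuous_const
        have h2 := (hU v).comp_continuous h1 fun t => mem_Ici.2 (le_max_right _ _)
        have h3 : Continuous fun t : ℝ => Real.exp (-(2 * max t 0)) := by fun_prop
        exact h3.smul h2)
      (‖z₀‖ + C) (by
        intro t
        have ht : 0 ≤ max t 0 := le_max_right _ _
        set r := max t 0
        have h1 := hT.norm_apply_le ht z₀
        have h2 := hT.norm_convolution_le (hfC v) ht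
        have h3 : ‖U v r‖ ≤ ‖z₀‖ + C * r := (norm_sub_le _ _).trans (add_le_add h1 h2)
        rw [norm_smul, Real.norm_of_nonneg (Real.exp_pos _).le, Real.exp_neg,
          inv_mul_le_iff₀ (Real.exp_pos _)]
        have h4 := Real.add_one_le_exp (2 * r)
        have h5 : ‖z₀‖ + C * r ≤ (2 * r + 1) * (‖z₀‖ + C) := by
          nlinarith [norm_nonneg z₀, mul_nonneg ht hC0, mul_nonneg ht (norm_nonneg z₀)]
        refine h3.trans (h5.trans ?_)
        gcongr)
  have hΦ : ContractingWith (1 / 2 : NNReal) Φ := by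
    refine ⟨by norm_num, LipschitzWith.of_dist_le_mul fun v w => ?_⟩
    rw [BoundedContinuousFunction.dist_le (by positivity)]
    intro t
    have ht : 0 ≤ max t 0 := le_max_right _ _
    change dist (Real.exp (-(2 * max t 0)) • U v (max t 0))
      (Real.exp (-(2 * max t 0)) • U w (max t 0)) ≤ _
    set r := max t 0
    have e : U v r - U w r = ∫ s in (0 : ℝ)..r, T (r - s) (f w s - f v s) := by
      simp only [map_sub]
      rw [intervalIntegral.integral_sub
        (hT.intervalIntegrable (hfm w) (hfC w) le_rfl ht le_rfl)
        (hT.intervalIntegrable (hfm v) (hfC v) le_rfl ht le_rfl)]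
      simp only [U]
      abel
    have h1 : ‖U v r - U w r‖ ≤ ∫ s in (0 : ℝ)..r, Real.exp (2 * s) * dist v w := by
      rw [e]
      refine intervalIntegral.norm_integral_le_of_norm_le ht (ae_of_all _ fun s hs => ?_)
        (Continuous.intervalIntegrable (by fun_prop) _ _)
      refine (hT.norm_apply_le (by linarith [hs.2]) _).trans ?_
      have h2 := hσ.dist_le_mul (Real.exp (2 * s) • w s + d s) (Real.exp (2 * s) • v s + d s)
      rw [NNReal.coe_one, one_mul, dist_add_right, dist_eq_norm, dist_eq_norm, ← smul_sub,
        norm_smul, Real.norm_of_nonneg (Real.exp_pos _).le] at h2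
      refine h2.trans ?_
      gcongr
      rw [← dist_eq_norm, dist_comm]
      exact BoundedContinuousFunction.dist_coe_le_dist s
    have h2 : ∫ s in (0 : ℝ)..r, Real.exp (2 * s) * dist v w =
        (Real.exp (2 * r) - 1) / 2 * dist v w := by
      rw [intervalIntegral.integral_mul_const, intervalIntegral.integral_comp_mul_left
        (fun x => Real.exp x) two_ne_zero]
      rw [mul_zero, integral_exp, Real.exp_zero, smul_eq_mul]
      ring
    rw [dist_eq_norm, ← smul_sub, norm_smul, Real.norm_of_nonneg (Real.exp_pos _).le,
      Real.exp_neg, inv_mul_le_iff₀ (Real.exp_pos _)]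
    rw [h2] at h1
    refine h1.trans ?_
    push_cast
    nlinarith [dist_nonneg (x := v) (y := w), Real.exp_pos (2 * r)]
  let v := hΦ.fixedPoint Φ
  have hv : Φ v = v := hΦ.fixedPoint_isFixedPt
  have hv' : ∀ t, 0 ≤ t → Real.exp (2 * t) • v t = U v t := by
    intro t ht
    have h1 : v t = Real.exp (-(2 * max t 0)) • U v (max t 0) :=
      congrArg (fun w : BoundedContinuousFunction ℝ H => w t) hv.symm
    rw [max_eq_left ht] at h1
    rw [h1, smul_smul, ← Real.exp_add]
    simp
  refine ⟨fun t => Real.exp (2 * t) • v t, ?_, fun t ht => ?_, fun t ht => hv' t ht⟩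
  · exact (hU v).congr fun t ht => hv' t ht
  · exact hT.intervalIntegrable (hfm v) (hfC v) le_rfl ht le_rfl

end Mild

end KdVISS

namespace KdVISS

/-! ### Energy identities for regularized mild solutions. -/

section Energy

variable {H : Type*} [NormedAddCommGroup H] [InnerProductSpace ℝ H] [CompleteSpace H]
  {T : ℝ → H →L[ℝ] H} {J B : H →L[ℝ] H} {f z : ℝ → H} {C : ℝ} {z₀ : H}

open IsContractionSemigroup in
/-- Increments of `J z`, for a mild solution `z` and a regularizing operator `J`. -/
theorem mild_increment (hT : IsContractionSemigroup T)
    (hcomm : ∀ r, 0 ≤ r → ∀ x, J (T r x) = T r (J x))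
    (hlip : ∀ r, 0 ≤ r → ∀ x, ‖T r (J x) - J x‖ ≤ r * ‖B x‖)
    (hf : AEStronglyMeasurable f (volume.restrict (Ioi 0))) (hC : ∀ s, ‖f s‖ ≤ C)
    (hz : ∀ t, 0 ≤ t → z t = T t z₀ + ∫ s in (0 : ℝ)..t, T (t - s) (f s))
    {t τ : ℝ} (ht : 0 ≤ t) (hτ : t ≤ τ) :
    ‖J (z τ) - (T (τ - t) (J (z t)) + ∫ s in t..τ, J (f s))‖ ≤ ‖B‖ * C * (τ - t) ^ 2 := by
  have hC0 : 0 ≤ C := (norm_nonneg _).trans (hC 0)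
  have hi := hT.intervalIntegrable hf hC ht hτ le_rfl
  have hJi : IntervalIntegrable (fun s => J (f s)) volume t τ :=
    intervalIntegrable_of_bounded (C := ‖J‖ * C) (J.continuous.comp_aestronglyMeasurable hf)
      (fun s => J.le_opNorm_of_le (hC s)) ht hτ
  have hJTi : IntervalIntegrable (fun s => J (T (τ - s) (f s))) volume t τ :=
    ⟨J.integrable_comp hi.1, J.integrable_comp hi.2⟩
  rw [hT.mild_restart hf hC hz ht hτ, map_add, hcomm _ (sub_nonneg.2 hτ),
    ← ContinuousLinearMap.intervalIntegral_comp_comm _ hi, add_sub_add_left_eq_sub,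
    ← intervalIntegral.integral_sub hJTi hJi]
  have h := intervalIntegral.norm_integral_le_of_norm_le_const (a := t) (b := τ)
    (C := ‖B‖ * C * (τ - t)) (f := fun s => J (T (τ - s) (f s)) - J (f s)) fun s hs => by
      rw [uIoc_of_le hτ] at hs
      rw [hcomm _ (sub_nonneg.2 hs.2)]
      refine (hlip _ (sub_nonneg.2 hs.2) _).trans ?_
      have h1 : ‖B (f s)‖ ≤ ‖B‖ * C := B.le_opNorm_of_le (hC s)
      have h2 : τ - s ≤ τ - t := by linarith [hs.1]
      rw [mul_comm]
      exact mul_le_mul h1 h2 (sub_nonneg.2 hs.2) (by positivity)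
  rw [abs_of_nonneg (sub_nonneg.2 hτ)] at h
  refine h.trans_eq ?_
  ring

/-- Up to an error `O((τ - t)²)`, `J z(τ)` is the free evolution of `J z(t)` plus a primitive of `J
f`. The derivative is one-sided, as the semigroup is only differentiated at `0⁺`, and `hF` restricts
it to times where the primitive is differentiable with the expected value. -/
theorem hasDerivWithinAt_mild (hT : IsContractionSemigroup T)
    (hcomm : ∀ r, 0 ≤ r → ∀ x, J (T r x) = T r (J x))
    (hlip : ∀ r, 0 ≤ r → ∀ x, ‖T r (J x) - J x‖ ≤ r * ‖B x‖)
    (hder : ∀ x, Tendsto (fun h : ℝ => h⁻¹ • (T h (J x) - J x)) (𝓝[>] 0) (𝓝 (B x)))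
    (hf : AEStronglyMeasurable f (volume.restrict (Ioi 0))) (hC : ∀ s, ‖f s‖ ≤ C)
    (hz : ∀ t, 0 ≤ t → z t = T t z₀ + ∫ s in (0 : ℝ)..t, T (t - s) (f s))
    {t : ℝ} (ht : 0 ≤ t)
    (hF : HasDerivAt (fun τ => ∫ s in t..τ, J (f s)) (J (f t)) t) :
    HasDerivWithinAt (fun τ => J (z τ)) (B (z t) + J (f t)) (Ioi t) t := by
  have h1 : HasDerivWithinAt (fun τ => T (τ - t) (J (z t))) (B (z t)) (Ioi t) t := by
    rw [hasDerivWithinAt_iff_tendsto_slope' (by simp)]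
    have hs : Tendsto (fun τ => τ - t) (𝓝[>] t) (𝓝[>] 0) := by
      refine tendsto_nhdsWithin_iff.2 ⟨?_, ?_⟩
      · have : Tendsto (fun τ => τ - t) (𝓝 t) (𝓝 (t - t)) := (continuous_sub_right t).tendsto t
        rw [sub_self] at this
        exact this.mono_left nhdsWithin_le_nhds
      · filter_upwards [self_mem_nhdsWithin] with τ hτ
        exact sub_pos.2 (mem_Ioi.1 hτ)
    refine ((hder (z t)).comp hs).congr fun τ => ?_
    simp [slope, hT.apply_zero]
  have h2 : HasDerivWithinAt (fun τ => J (z τ) - (T (τ - t) (J (z t)) + ∫ s in t..τ, J (f s)))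
      0 (Ioi t) t := by
    have h0 : J (z t) - (T (t - t) (J (z t)) + ∫ s in t..t, J (f s)) = 0 := by
      simp [hT.apply_zero]
    rw [hasDerivWithinAt_iff_tendsto_slope' (by simp)]
    have hl : Tendsto (fun τ => ‖B‖ * C * (τ - t)) (𝓝[>] t) (𝓝 0) := by
      have : Tendsto (fun τ => ‖B‖ * C * (τ - t)) (𝓝 t) (𝓝 (‖B‖ * C * (t - t))) :=
        (continuous_const.mul (continuous_sub_right t)).tendsto t
      rw [sub_self, mul_zero] at this
      exact this.mono_left nhdsWithin_le_nhds
    refine squeeze_zero_norm' ?_ hl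
    filter_upwards [self_mem_nhdsWithin] with τ hτ
    have hτ : t < τ := hτ
    have h3 := mild_increment hT hcomm hlip hf hC hz ht hτ.le
    have hp : 0 < τ - t := sub_pos.2 hτ
    rw [slope, h0, vsub_eq_sub, sub_zero, norm_smul, norm_inv, Real.norm_of_nonneg hp.le,
      inv_mul_le_iff₀ hp]
    exact h3.trans_eq (by ring)
  refine ((h2.add (h1.add hF.hasDerivWithinAt)).congr_of_eventuallyEq
    (Eventually.of_forall fun τ => ?_) ?_).congr_deriv (by simp)
  · simp
  · simp

/-- Energy identity for the regularization `J z` of a mild solution `z`. -/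
theorem mild_energy_identity (hT : IsContractionSemigroup T)
    (hcomm : ∀ r, 0 ≤ r → ∀ x, J (T r x) = T r (J x))
    (hlip : ∀ r, 0 ≤ r → ∀ x, ‖T r (J x) - J x‖ ≤ r * ‖B x‖)
    (hder : ∀ x, Tendsto (fun h : ℝ => h⁻¹ • (T h (J x) - J x)) (𝓝[>] 0) (𝓝 (B x)))
    (hf : AEStronglyMeasurable f (volume.restrict (Ioi 0))) (hC : ∀ s, ‖f s‖ ≤ C)
    (hz : ∀ t, 0 ≤ t → z t = T t z₀ + ∫ s in (0 : ℝ)..t, T (t - s) (f s))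
    (hzc : ContinuousOn z (Ici 0))
    {S : H →L[ℝ] H} (hS : ∀ x y, inner ℝ (S x) y = inner ℝ x (S y))
    {a b : ℝ} (ha : 0 ≤ a) (hab : a ≤ b) :
    inner ℝ (J (z b)) (S (J (z b))) - inner ℝ (J (z a)) (S (J (z a))) =
      ∫ s in a..b, 2 * inner ℝ (B (z s) + J (f s)) (S (J (z s))) := by
  have hC0 : 0 ≤ C := (norm_nonneg _).trans (hC 0)
  obtain ⟨K, hK⟩ := (isCompact_Icc (a := a) (b := b)).exists_bound_of_continuousOn
    (hzc.mono fun s hs => ha.trans hs.1)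
  have hK0 : 0 ≤ K := (norm_nonneg _).trans (hK a ⟨le_rfl, hab⟩)
  have hJK : ∀ s ∈ Icc a b, ‖J (z s)‖ ≤ ‖J‖ * K := fun s hs => J.le_opNorm_of_le (hK s hs)
  have hJi : ∀ t τ, a ≤ t → t ≤ τ → IntervalIntegrable (fun s => J (f s)) volume t τ :=
    fun t τ hat htτ => intervalIntegrable_of_bounded (C := ‖J‖ * C)
      (J.continuous.comp_aestronglyMeasurable hf)
      (fun s => J.le_opNorm_of_le (hC s)) (ha.trans hat) htτ
  set D : ℝ := ‖B‖ * K + ‖J‖ * C + ‖B‖ * C * (b - a) with hD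
  have hD0 : 0 ≤ D := by
    have : 0 ≤ b - a := sub_nonneg.2 hab
    positivity
  have hylip : ∀ t ∈ Icc a b, ∀ τ ∈ Icc a b, t ≤ τ → ‖J (z τ) - J (z t)‖ ≤ D * (τ - t) := by
    intro t ht τ hτ htτ
    have h1 := mild_increment hT hcomm hlip hf hC hz (ha.trans ht.1) htτ
    have h2 := hlip (τ - t) (sub_nonneg.2 htτ) (z t)
    have h3 : ‖B (z t)‖ ≤ ‖B‖ * K := B.le_opNorm_of_le (hK t ht)
    have h4 := intervalIntegral.norm_integral_le_of_norm_le_const (a := t) (b := τ)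
      (C := ‖J‖ * C) (f := fun s => J (f s)) fun s hs => J.le_opNorm_of_le (hC s)
    have hp := sub_nonneg.2 htτ
    rw [abs_of_nonneg hp] at h4
    have e : J (z τ) - J (z t) = (J (z τ) - (T (τ - t) (J (z t)) + ∫ s in t..τ, J (f s))) +
        (T (τ - t) (J (z t)) - J (z t)) + ∫ s in t..τ, J (f s) := by abel
    rw [e]
    refine norm_add₃_le.trans ?_
    have h5 : (τ - t) * ‖B (z t)‖ ≤ (τ - t) * (‖B‖ * K) := by gcongr
    have h6 : ‖B‖ * C * (τ - t) ^ 2 ≤ ‖B‖ * C * (b - a) * (τ - t) := by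
      have : (τ - t) ≤ b - a := by linarith [ht.1, hτ.2]
      rw [sq, ← mul_assoc]
      gcongr
    rw [hD]
    linarith
  -- `φ` is Lipschitz on `[a, b]`, hence absolutely continuous, hence the integral of its almost
  -- everywhere derivative.
  set φ : ℝ → ℝ := fun t => inner ℝ (J (z t)) (S (J (z t))) with hφ
  have hφlip : ∀ t ∈ Icc a b, ∀ τ ∈ Icc a b, t ≤ τ →
      ‖φ τ - φ t‖ ≤ 2 * ‖S‖ * (‖J‖ * K) * D * (τ - t) := by
    intro t ht τ hτ htτ
    have e : φ τ - φ t = inner ℝ (J (z τ) - J (z t)) (S (J (z τ))) +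
        inner ℝ (J (z t)) (S (J (z τ) - J (z t))) := by
      simp only [hφ, map_sub, inner_sub_left, inner_sub_right]
      ring
    have h0 := hylip t ht τ hτ htτ
    rw [e]
    have h1 : ‖inner ℝ (J (z τ) - J (z t)) (S (J (z τ)))‖ ≤
        D * (τ - t) * (‖S‖ * (‖J‖ * K)) := by
      refine (norm_inner_le_norm _ _).trans ?_
      have := S.le_opNorm_of_le (hJK τ hτ)
      have := sub_nonneg.2 htτ
      gcongr
    have h2 : ‖inner ℝ (J (z t)) (S (J (z τ) - J (z t)))‖ ≤
        ‖J‖ * K * (‖S‖ * (D * (τ - t))) := by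
      refine (norm_inner_le_norm _ _).trans ?_
      have := S.le_opNorm_of_le h0
      have := hJK t ht
      gcongr
    refine (norm_add_le _ _).trans ((add_le_add h1 h2).trans_eq (by ring))
  have hac : AbsolutelyContinuousOnInterval φ a b := by
    refine LipschitzOnWith.absolutelyContinuousOnInterval
      (K := ⟨2 * ‖S‖ * (‖J‖ * K) * D, by positivity⟩) ?_
    rw [uIcc_of_le hab]
    refine LipschitzOnWith.of_dist_le_mul fun τ hτ t ht => ?_
    rcases le_total t τ with h | h
    · rw [Real.dist_eq, Real.dist_eq, abs_of_nonneg (sub_nonneg.2 h)]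
      exact hφlip t ht τ hτ h
    · rw [dist_comm, dist_comm τ t, Real.dist_eq, Real.dist_eq, abs_of_nonneg (sub_nonneg.2 h)]
      exact hφlip τ hτ t ht h
  rw [← hac.integral_deriv_eq_sub]
  refine intervalIntegral.integral_congr_ae ?_
  filter_upwards [hac.ae_differentiableAt, (hJi a b le_rfl hab).ae_hasDerivAt_integral]
    with t h1 h2 ht
  have ht' : t ∈ uIcc a b := uIoc_subset_uIcc ht
  have h3 := h2 ht' t ht'
  have ht0 : 0 ≤ t := by
    rw [uIcc_of_le hab] at ht'
    exact ha.trans ht'.1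
  have h4 := hasDerivWithinAt_mild hT hcomm hlip hder hf hC hz ht0 h3
  have h5 := h4.inner ℝ (S.hasFDerivAt.comp_hasDerivWithinAt t h4)
  have h6 := (h1 ht').hasDerivAt.hasDerivWithinAt (s := Ioi t)
  -- Where `φ` is differentiable, its derivative is the known right derivative; symmetry of `S`
  -- merges the two terms of the product rule.
  rw [UniqueDiffWithinAt.eq_deriv _ (uniqueDiffWithinAt_Ioi t) h6 h5, ← hS, two_mul,
    real_inner_comm]
  rfl

end Energy

end KdVISS

namespace KdVISS

/-! ### Weak derivatives on an interval and the du Bois-Reymond lemma. -/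

section WeakDerivative

/-- Integration by parts for a primitive `G` of an integrable function `g` and a `C¹` function. -/
theorem integral_mul_eq_of_primitive {a b : ℝ} (hab : a ≤ b) {g G v v' : ℝ → ℝ}
    (hg : IntervalIntegrable g volume a b)
    (hG : ∀ x ∈ Icc a b, G x = G a + ∫ t in a..x, g t)
    (hv : ∀ x, HasDerivAt v (v' x) x) (hv' : Continuous v') :
    ∫ x in a..b, g x * v x = G b * v b - G a * v a - ∫ x in a..b, G x * v' x := by
  have hac : AbsolutelyContinuousOnInterval (fun x => G a + ∫ t in a..x, g t) a b :=
    (contDiffOn_const.absolutelyContinuousOnInterval).add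
      (hg.absolutelyContinuousOnInterval_intervalIntegral left_mem_uIcc)
  have hdv : deriv v = v' := funext fun x => (hv x).deriv
  have hvc : ContDiff ℝ 1 v := by
    rw [contDiff_one_iff_deriv, hdv]
    exact ⟨fun x => (hv x).differentiableAt, hv'⟩
  have h := hvc.contDiffOn.absolutelyContinuousOnInterval.integral_mul_deriv_eq_deriv_mul hac
  have e1 : ∫ x in a..b, v x * deriv (fun x => G a + ∫ t in a..x, g t) x =
      ∫ x in a..b, g x * v x := by
    refine intervalIntegral.integral_congr_ae ?_
    filter_upwards [hg.ae_hasDerivAt_integral] with x hx hxI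
    rw [((hx (uIoc_subset_uIcc hxI) a left_mem_uIcc).const_add (G a)).deriv, mul_comm]
  have e2 : ∫ x in a..b, deriv v x * (G a + ∫ t in a..x, g t) = ∫ x in a..b, G x * v' x := by
    refine intervalIntegral.integral_congr fun x hx => ?_
    rw [uIcc_of_le hab] at hx
    simp only [hdv]
    rw [← hG x hx, mul_comm]
  rw [e1, e2, ← hG b ⟨hab, le_rfl⟩] at h
  rw [h, intervalIntegral.integral_same, add_zero]
  ring

theorem setIntegral_Ioo_eq {L : ℝ} (hL : 0 ≤ L) (f : ℝ → ℝ) :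
    ∫ x in Ioo (0 : ℝ) L, f x = ∫ x in (0 : ℝ)..L, f x := by
  rw [intervalIntegral.integral_of_le hL, integral_Ioc_eq_integral_Ioo]

theorem L2.integrableOn {L : ℝ} (f : L2 L) : IntegrableOn f (Ioo 0 L) volume :=
  (Lp.memLp f).integrable (by norm_num)

theorem L2.intervalIntegrable {L : ℝ} (hL : 0 ≤ L) (f : L2 L) :
    IntervalIntegrable f volume 0 L := by
  rw [intervalIntegrable_iff_integrableOn_Ioo_of_le hL]
  exact f.integrableOn

theorem eq_zero_of_notMem_tsupport_subset {φ : ℝ → ℝ} {s : Set ℝ} (h : tsupport φ ⊆ s) {x : ℝ}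
    (hx : x ∉ s) : φ x = 0 :=
  image_eq_zero_of_notMem_tsupport fun h' => hx (h h')

/-- A function with an integrable classical derivative has it as weak derivative. -/
theorem HasWeakDeriv.of_primitive {L : ℝ} (hL : 0 ≤ L) {f g : L2 L} {G : ℝ → ℝ}
    (hf : f =ᵐ[volume.restrict (Ioo (0 : ℝ) L)] G)
    (hG : ∀ x ∈ Icc 0 L, G x = G 0 + ∫ t in (0 : ℝ)..x, g t) : HasWeakDeriv L f g := by
  intro φ hφ hφc hφs
  have h := integral_mul_eq_of_primitive hL (L2.intervalIntegrable hL g) hG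
    (fun x => (hφ.differentiable (by simp) x).hasDerivAt) (hφ.continuous_deriv (by simp))
  rw [eq_zero_of_notMem_tsupport_subset hφs (x := 0) (by simp),
    eq_zero_of_notMem_tsupport_subset hφs (x := L) (by simp)] at h
  have e : ∫ x in Ioo (0 : ℝ) L, f x * deriv φ x = ∫ x in Ioo (0 : ℝ) L, G x * deriv φ x := by
    refine integral_congr_ae ?_
    filter_upwards [hf] with x hx
    rw [hx]
  rw [e, setIntegral_Ioo_eq hL, setIntegral_Ioo_eq hL, h]
  ring

theorem setIntegral_Ioo_eq_integral {L : ℝ} {F : ℝ → ℝ} (h : ∀ x ∉ Ioo (0 : ℝ) L, F x = 0) :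
    ∫ x in Ioo (0 : ℝ) L, F x = ∫ x, F x :=
  setIntegral_eq_integral_of_forall_compl_eq_zero h

theorem ae_eq_zero_of_weak {L : ℝ} {h : ℝ → ℝ} (hh : IntegrableOn h (Ioo 0 L) volume)
    (H : ∀ φ : ℝ → ℝ, ContDiff ℝ ∞ φ → HasCompactSupport φ → tsupport φ ⊆ Ioo 0 L →
      ∫ x in Ioo (0 : ℝ) L, h x * φ x = 0) :
    ∀ᵐ x ∂volume.restrict (Ioo (0 : ℝ) L), h x = 0 := by
  rw [ae_restrict_iff' measurableSet_Ioo]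
  refine IsOpen.ae_eq_zero_of_integral_contDiff_smul_eq_zero (f := h) isOpen_Ioo
    hh.locallyIntegrableOn fun φ hφ hφc hφs => ?_
  have e := setIntegral_Ioo_eq_integral (L := L) (F := fun x => φ x • h x) fun x hx => by
    rw [eq_zero_of_notMem_tsupport_subset hφs hx, zero_smul]
  have h0 := H φ hφ hφc hφs
  simp only [mul_comm (h _)] at h0
  exact e.symm.trans h0

/-- The **du Bois-Reymond lemma** on `(0, L)`. -/
theorem exists_ae_eq_const_of_weak {L : ℝ} (hL : 0 < L) {h : ℝ → ℝ}
    (hh : IntegrableOn h (Ioo 0 L) volume)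
    (H : ∀ φ : ℝ → ℝ, ContDiff ℝ ∞ φ → HasCompactSupport φ → tsupport φ ⊆ Ioo 0 L →
      ∫ x in Ioo (0 : ℝ) L, h x * deriv φ x = 0) :
    ∃ c : ℝ, ∀ᵐ x ∂volume.restrict (Ioo (0 : ℝ) L), h x = c := by
  let β : ContDiffBump (L / 2) := ⟨L / 8, L / 4, by positivity, by linarith⟩
  set ψ : ℝ → ℝ := β.normed volume with hψ
  have hψd : ContDiff ℝ ∞ ψ := β.contDiff_normed
  have hψs : tsupport ψ ⊆ Ioo 0 L := by
    rw [hψ, β.tsupport_normed_eq, Real.closedBall_eq_Icc]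
    exact fun x hx => ⟨by linarith [hx.1, show β.rOut = L / 4 from rfl],
      by linarith [hx.2, show β.rOut = L / 4 from rfl]⟩
  have hψc : HasCompactSupport ψ := β.hasCompactSupport_normed
  have hψ1 : ∫ x, ψ x = 1 := β.integral_normed
  have hint : ∀ φ : ℝ → ℝ, Continuous φ → HasCompactSupport φ →
      IntegrableOn (fun x => h x * φ x) (Ioo 0 L) volume := by
    intro φ hφ hφc
    obtain ⟨C, hC⟩ := hφ.bounded_above_of_compact_support hφc
    exact hh.mul_bdd hφ.aestronglyMeasurable (ae_of_all _ hC)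
  refine ⟨∫ x in Ioo (0 : ℝ) L, h x * ψ x, ?_⟩
  set c := ∫ x in Ioo (0 : ℝ) L, h x * ψ x with hc
  have key := ae_eq_zero_of_weak (L := L) (h := fun x => h x - c)
    (hh.sub (integrableOn_const (by simp))) ?_
  · filter_upwards [key] with x hx
    exact sub_eq_zero.1 hx
  intro θ hθ hθc hθs
  set m := ∫ x, θ x with hm
  -- Subtracting the mean against the unit-mass bump `ψ` leaves a function of mean zero, whose
  -- primitive has compact support in `(0, L)` and is an admissible test function.
  set η : ℝ → ℝ := fun x => θ x - m * ψ x with hη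
  have hηd : ContDiff ℝ ∞ η := hθ.sub (contDiff_const.mul hψd)
  obtain ⟨a, b, ha, hb, hab⟩ : ∃ a b : ℝ, 0 < a ∧ b < L ∧ Function.support η ⊆ Ioc a b := by
    have hK : IsCompact (tsupport θ ∪ tsupport ψ) := hθc.union hψc
    have hne : (tsupport θ ∪ tsupport ψ).Nonempty := by
      refine ⟨L / 2, Or.inr ?_⟩
      rw [hψ, β.tsupport_normed_eq]
      exact Metric.mem_closedBall_self β.rOut_pos.le
    obtain ⟨a, ha, ha'⟩ := hK.exists_isLeast hne
    obtain ⟨b, hb, hb'⟩ := hK.exists_isGreatest hne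
    have hsub := union_subset hθs hψs
    -- The half-open interval omits its left endpoint, so the minimum `a` of the support is replaced
    -- by `a / 2`.
    refine ⟨a / 2, b, by linarith [(hsub ha).1], (hsub hb).2, fun x hx => ?_⟩
    have hx' : x ∈ tsupport θ ∪ tsupport ψ := by
      by_contra hn
      rw [mem_union, not_or] at hn
      exact hx (by simp [hη, image_eq_zero_of_notMem_tsupport hn.1,
        image_eq_zero_of_notMem_tsupport hn.2])
    exact ⟨by linarith [ha' hx', (hsub ha).1], hb' hx'⟩
  have hθi : Integrable θ := hθ.continuous.integrable_of_hasCompactSupport hθc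
  have hψi : Integrable ψ := hψd.continuous.integrable_of_hasCompactSupport hψc
  have hη0 : ∫ x, η x = 0 := by
    rw [hη, integral_sub hθi (hψi.const_mul m), integral_const_mul, hψ1, mul_one, sub_self]
  set φ : ℝ → ℝ := fun x => ∫ t in (0 : ℝ)..x, η t with hφ
  have hdφ : deriv φ = η := funext fun x => hηd.continuous.deriv_integral _ _ _
  have hφd : ContDiff ℝ ∞ φ := by
    rw [contDiff_infty_iff_deriv, hdφ]
    exact ⟨fun x => (intervalIntegral.integral_hasDerivAt_right
      (hηd.continuous.intervalIntegrable _ _) (hηd.continuous.stronglyMeasurableAtFilter _ _)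
      hηd.continuous.continuousAt).differentiableAt, hηd⟩
  have hφs : Function.support φ ⊆ Icc a b := by
    intro x hx
    by_contra hn
    apply hx
    have hz : ∀ t ∉ Ioc a b, η t = 0 := fun t ht => by
      by_contra h0
      exact ht (hab h0)
    by_cases hxa : x < a
    · refine (intervalIntegral.integral_congr (g := fun _ => 0) fun t ht => ?_).trans (by simp)
      refine hz t fun h' => ?_
      have h2 : max 0 x < a := max_lt ha hxa
      exact absurd h'.1 (not_lt.2 (ht.2.trans h2.le))
    · have hxb : b < x := by
        by_contra h'
        exact hn ⟨not_lt.1 hxa, not_lt.1 h'⟩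
      rw [hφ]
      simp only
      rw [intervalIntegral.integral_eq_integral_of_support_subset, hη0]
      exact hab.trans (Ioc_subset_Ioc ha.le hxb.le)
  have hφt : tsupport φ ⊆ Icc a b := closure_minimal hφs isClosed_Icc
  have h0 := H φ hφd (HasCompactSupport.of_support_subset_isCompact isCompact_Icc hφs)
    (hφt.trans (Icc_subset_Ioo ha hb))
  rw [hdφ] at h0
  have hI1 := hint θ hθ.continuous hθc
  have hI2 := hint ψ hψd.continuous hψc
  have e1 : ∫ x in Ioo (0 : ℝ) L, h x * η x = (∫ x in Ioo (0 : ℝ) L, h x * θ x) - m * c := by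
    rw [hc, ← integral_const_mul, ← integral_sub hI1 (hI2.const_mul m)]
    refine integral_congr_ae (ae_of_all _ fun x => ?_)
    simp only [hη]
    ring
  have e2 : ∫ x in Ioo (0 : ℝ) L, (h x - c) * θ x =
      (∫ x in Ioo (0 : ℝ) L, h x * θ x) - c * m := by
    have : ∫ x in Ioo (0 : ℝ) L, θ x = m :=
      setIntegral_Ioo_eq_integral fun x hx => eq_zero_of_notMem_tsupport_subset hθs hx
    rw [← this, ← integral_const_mul, ← integral_sub hI1 (hθi.integrableOn.const_mul c)]
    refine integral_congr_ae (ae_of_all _ fun x => ?_)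
    simp only
    ring
  rw [e2, mul_comm c m, ← e1, h0]

/-- A function with weak derivative `g` is a primitive of `g` up to a constant. -/
theorem HasWeakDeriv.exists_primitive {L : ℝ} (hL : 0 < L) {f g : L2 L}
    (h : HasWeakDeriv L f g) :
    ∃ c : ℝ, f =ᵐ[volume.restrict (Ioo (0 : ℝ) L)] fun x => c + ∫ t in (0 : ℝ)..x, g t := by
  set G : ℝ → ℝ := fun x => ∫ t in (0 : ℝ)..x, g t with hG
  have hgi := L2.intervalIntegrable hL.le g
  have hGc : ContinuousOn G (Icc 0 L) := by
    have := intervalIntegral.continuousOn_primitive_interval'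
      hgi left_mem_uIcc
    rwa [uIcc_of_le hL.le] at this
  have hGi : IntegrableOn G (Ioo 0 L) volume :=
    (hGc.integrableOn_Icc).mono_set Ioo_subset_Icc_self
  obtain ⟨c, hc⟩ := exists_ae_eq_const_of_weak hL (h := fun x => f x - G x)
    (f.integrableOn.sub hGi) fun φ hφ hφc hφs => by
      have h1 := h φ hφ hφc hφs
      have h2 := integral_mul_eq_of_primitive (G := G) hL.le hgi (fun x _ => by simp [hG])
        (fun x => (hφ.differentiable (by simp) x).hasDerivAt) (hφ.continuous_deriv (by simp))
      rw [eq_zero_of_notMem_tsupport_subset hφs (x := 0) (by simp),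
        eq_zero_of_notMem_tsupport_subset hφs (x := L) (by simp), ← setIntegral_Ioo_eq hL.le,
        ← setIntegral_Ioo_eq hL.le] at h2
      obtain ⟨C, hC⟩ := (hφ.continuous_deriv (by simp)).bounded_above_of_compact_support
        hφc.deriv
      have hm := (hφ.continuous_deriv (by simp)).aestronglyMeasurable
        (μ := volume.restrict (Ioo 0 L))
      simp only [sub_mul]
      rw [integral_sub (f.integrableOn.mul_bdd hm (ae_of_all _ hC))
        (hGi.mul_bdd hm (ae_of_all _ hC)), h1]
      linarith
  refine ⟨c, ?_⟩
  filter_upwards [hc] with x hx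
  linarith

end WeakDerivative

end KdVISS

namespace KdVISS

/-! ### Classical representatives of elements of the domain and multiplier identities. -/

section Operator

variable {L : ℝ}

/-- A `C²` function `u` on the line, with `u''` absolutely continuous on `[0, L]` and
`u''' = g` there, which satisfies the boundary conditions. -/
structure IsKdVProfile (L : ℝ) (u u₁ u₂ : ℝ → ℝ) (g : L2 L) : Prop where
  hasDerivAt : ∀ x, HasDerivAt u (u₁ x) x
  hasDerivAt₁ : ∀ x, HasDerivAt u₁ (u₂ x) x
  continuous₂ : Continuous u₂
  eq₂ : ∀ x ∈ Icc 0 L, u₂ x = u₂ 0 + ∫ t in (0 : ℝ)..x, g t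
  left : u 0 = 0
  right : u L = 0
  right₁ : u₁ L = 0

theorem memLp_of_continuous {u : ℝ → ℝ} (hu : Continuous u) :
    MemLp u 2 (volume.restrict (Ioo (0 : ℝ) L)) := by
  obtain ⟨C, hC⟩ := (isCompact_Icc (a := (0 : ℝ)) (b := L)).exists_bound_of_continuousOn
    hu.continuousOn
  refine MemLp.of_bound hu.aestronglyMeasurable C ?_
  filter_upwards [ae_restrict_mem measurableSet_Ioo] with x hx
  exact hC x (Ioo_subset_Icc_self hx)

theorem eqOn_Icc_of_ae_eq_Ioo (hL : 0 < L) {u v : ℝ → ℝ} (hu : ContinuousOn u (Icc 0 L))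
    (hv : ContinuousOn v (Icc 0 L)) (h : u =ᵐ[volume.restrict (Ioo (0 : ℝ) L)] v) :
    EqOn u v (Icc 0 L) := by
  refine Measure.eqOn_Icc_of_ae_eq volume hL.ne ?_ hu hv
  rwa [← restrict_Ioo_eq_restrict_Icc]

theorem HasWeakDeriv.exists_hasDerivAt (hL : 0 < L) {f g : L2 L} (h : HasWeakDeriv L f g)
    {u' : ℝ → ℝ} (hu' : Continuous u') (hg : g =ᵐ[volume.restrict (Ioo (0 : ℝ) L)] u') :
    ∃ u : ℝ → ℝ, (∀ x, HasDerivAt u (u' x) x) ∧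
      f =ᵐ[volume.restrict (Ioo (0 : ℝ) L)] u := by
  obtain ⟨c, hc⟩ := h.exists_primitive hL
  refine ⟨fun x => c + ∫ t in (0 : ℝ)..x, u' t, fun x => ?_, ?_⟩
  · exact (intervalIntegral.integral_hasDerivAt_right (hu'.intervalIntegrable _ _)
      (hu'.stronglyMeasurableAtFilter _ _) hu'.continuousAt).const_add c
  · filter_upwards [hc, ae_restrict_mem measurableSet_Ioo] with x hx hxI
    rw [hx]
    congr 1
    refine intervalIntegral.integral_congr_ae ?_
    filter_upwards [(ae_restrict_iff' measurableSet_Ioo).1 hg] with t ht htI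
    rw [uIoc_of_le hxI.1.le] at htI
    exact ht ⟨htI.1, htI.2.trans_lt hxI.2⟩

/-- Reduces later integrations by parts to classical functions. The boundary conditions transfer
because continuous representatives that agree almost everywhere on `(0, L)` agree at the endpoints.
-/
theorem KdVOperator.exists_profile (hL : 0 < L) {z w : L2 L} (h : KdVOperator L z w) :
    ∃ u u₁ u₂ g, IsKdVProfile L u u₁ u₂ g ∧ z =ᵐ[volume.restrict (Ioo (0 : ℝ) L)] u ∧
      w =ᵐ[volume.restrict (Ioo (0 : ℝ) L)] fun x => -u₁ x - g x := by
  obtain ⟨z₁, z₂, z₃, h1, h2, h3, ⟨v, hv, hv0, hvL⟩, ⟨v₁, hv₁, hv₁L⟩, rfl⟩ := h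
  obtain ⟨c, hc⟩ := h3.exists_primitive hL
  have hind : Integrable ((Ioo 0 L).indicator z₃) volume :=
    (integrable_indicator_iff measurableSet_Ioo).2 z₃.integrableOn
  -- Extending `z₃` by zero makes `u₂` continuous on the whole line, so `u₁` and `u` are
  -- differentiable everywhere, endpoints included.
  set u₂ : ℝ → ℝ := fun x => c + ∫ t in (0 : ℝ)..x, (Ioo 0 L).indicator z₃ t with hu₂
  have hu₂c : Continuous u₂ := continuous_const.add (hind.continuous_primitive 0)
  have hu₂e : ∀ x ∈ Icc 0 L, u₂ x = c + ∫ t in (0 : ℝ)..x, z₃ t := by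
    intro x hx
    simp only [hu₂]
    congr 1
    refine intervalIntegral.integral_congr_ae ?_
    have hne : ∀ᵐ t : ℝ, t ≠ L := Measure.ae_ne _ _
    filter_upwards [hne] with t ht htI
    rw [uIoc_of_le hx.1] at htI
    exact indicator_of_mem (show t ∈ Ioo 0 L from
      ⟨htI.1, lt_of_le_of_ne (htI.2.trans hx.2) ht⟩) _
  have hz₂ : z₂ =ᵐ[volume.restrict (Ioo (0 : ℝ) L)] u₂ := by
    filter_upwards [hc, ae_restrict_mem measurableSet_Ioo] with x hx hxI
    rw [hx, hu₂e x (Ioo_subset_Icc_self hxI)]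
  obtain ⟨u₁, hu₁, hz₁⟩ := h2.exists_hasDerivAt hL hu₂c hz₂
  have hu₁c : Continuous u₁ := continuous_iff_continuousAt.2 fun x => (hu₁ x).continuousAt
  obtain ⟨u, hu, hz⟩ := h1.exists_hasDerivAt hL hu₁c hz₁
  have huc : Continuous u := continuous_iff_continuousAt.2 fun x => (hu x).continuousAt
  have e := eqOn_Icc_of_ae_eq_Ioo hL huc.continuousOn hv.1 (hz.symm.trans hv.2)
  have e₁ := eqOn_Icc_of_ae_eq_Ioo hL hu₁c.continuousOn hv₁.1 (hz₁.symm.trans hv₁.2)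
  have m0 : (0 : ℝ) ∈ Icc 0 L := ⟨le_rfl, hL.le⟩
  have mL : L ∈ Icc 0 L := ⟨hL.le, le_rfl⟩
  refine ⟨u, u₁, u₂, z₃, ⟨hu, hu₁, hu₂c, fun x hx => ?_, (e m0).trans hv0, (e mL).trans hvL,
    (e₁ mL).trans hv₁L⟩, hz, ?_⟩
  · rw [hu₂e x hx, hu₂e 0 m0, intervalIntegral.integral_same, add_zero]
  · filter_upwards [hz₁, Lp.coeFn_sub (-z₁) z₃, Lp.coeFn_neg z₁] with x hx1 hx2 hx3
    rw [hx2, Pi.sub_apply, hx3, Pi.neg_apply, hx1]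

theorem eq_add_integral_of_hasDerivAt {u u' : ℝ → ℝ} (h : ∀ x, HasDerivAt u (u' x) x)
    (hu' : Continuous u') (x : ℝ) : u x = u 0 + ∫ t in (0 : ℝ)..x, u' t := by
  rw [intervalIntegral.integral_eq_sub_of_hasDerivAt (fun t _ => h t)
    (hu'.intervalIntegrable _ _)]
  ring

theorem HasWeakDeriv.of_hasDerivAt (hL : 0 ≤ L) {f g : L2 L} {u u' : ℝ → ℝ}
    (h : ∀ x, HasDerivAt u (u' x) x) (hu' : Continuous u')
    (hf : f =ᵐ[volume.restrict (Ioo (0 : ℝ) L)] u)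
    (hg : g =ᵐ[volume.restrict (Ioo (0 : ℝ) L)] u') : HasWeakDeriv L f g := by
  refine HasWeakDeriv.of_primitive hL hf fun x hx => ?_
  rw [eq_add_integral_of_hasDerivAt h hu' x]
  congr 1
  refine intervalIntegral.integral_congr_ae ?_
  have hne : ∀ᵐ t : ℝ, t ≠ L := Measure.ae_ne _ _
  filter_upwards [(ae_restrict_iff' measurableSet_Ioo).1 hg, hne] with t ht htL htI
  rw [uIoc_of_le hx.1] at htI
  exact (ht ⟨htI.1, lt_of_le_of_ne (htI.2.trans hx.2) htL⟩).symm

namespace IsKdVProfile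

variable {u u₁ u₂ : ℝ → ℝ} {g : L2 L}

theorem continuous (h : IsKdVProfile L u u₁ u₂ g) : Continuous u :=
  continuous_iff_continuousAt.2 fun x => (h.hasDerivAt x).continuousAt

theorem continuous₁ (h : IsKdVProfile L u u₁ u₂ g) : Continuous u₁ :=
  continuous_iff_continuousAt.2 fun x => (h.hasDerivAt₁ x).continuousAt

theorem kdVOperator (hL : 0 ≤ L) (h : IsKdVProfile L u u₁ u₂ g) {z w : L2 L}
    (hz : z =ᵐ[volume.restrict (Ioo (0 : ℝ) L)] u)
    (hw : w =ᵐ[volume.restrict (Ioo (0 : ℝ) L)] fun x => -u₁ x - g x) :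
    KdVOperator L z w := by
  have m1 := memLp_of_continuous (L := L) h.continuous₁
  have m2 := memLp_of_continuous (L := L) h.continuous₂
  refine ⟨m1.toLp, m2.toLp, g, ?_, ?_, ?_, ⟨u, ⟨h.continuous.continuousOn, hz⟩, h.left, h.right⟩,
    ⟨u₁, ⟨h.continuous₁.continuousOn, m1.coeFn_toLp⟩, h.right₁⟩, ?_⟩
  · exact HasWeakDeriv.of_hasDerivAt hL h.hasDerivAt h.continuous₁ hz m1.coeFn_toLp
  · exact HasWeakDeriv.of_hasDerivAt hL h.hasDerivAt₁ h.continuous₂ m1.coeFn_toLp m2.coeFn_toLp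
  · exact HasWeakDeriv.of_primitive hL m2.coeFn_toLp h.eq₂
  · refine Lp.ext ?_
    filter_upwards [hw, Lp.coeFn_sub (-m1.toLp) g, Lp.coeFn_neg m1.toLp, m1.coeFn_toLp]
      with x h1 h2 h3 h4
    rw [h1, h2, Pi.sub_apply, h3, Pi.neg_apply, h4]

theorem integral_mul_self (h : IsKdVProfile L u u₁ u₂ g) :
    ∫ x in (0 : ℝ)..L, u₁ x * u x = 0 := by
  have e := intervalIntegral.integral_eq_sub_of_hasDerivAt (a := 0) (b := L)
    (f := fun x => u x ^ 2 / 2) (f' := fun x => u₁ x * u x) (fun x _ => by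
      refine (((h.hasDerivAt x).pow 2).div_const 2).congr_deriv ?_
      simp
      ring) ((h.continuous₁.mul h.continuous).intervalIntegrable _ _)
  rw [e, h.left, h.right, sub_self]

/-- The boundary conditions kill every boundary term except the trace of `u'` at `0`, which has the
dissipative sign. -/
theorem integral_third_mul (hL : 0 ≤ L) (h : IsKdVProfile L u u₁ u₂ g) :
    ∫ x in (0 : ℝ)..L, g x * u x = u₁ 0 ^ 2 / 2 := by
  have e := intervalIntegral.integral_eq_sub_of_hasDerivAt (a := 0) (b := L)
    (f := fun x => u₁ x ^ 2 / 2) (f' := fun x => u₂ x * u₁ x) (fun x _ => by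
      refine (((h.hasDerivAt₁ x).pow 2).div_const 2).congr_deriv ?_
      simp
      ring) ((h.continuous₂.mul h.continuous₁).intervalIntegrable _ _)
  rw [integral_mul_eq_of_primitive hL (L2.intervalIntegrable hL g) h.eq₂ h.hasDerivAt
    h.continuous₁, e, h.left, h.right, h.right₁]
  ring

theorem integral_mul_weight (h : IsKdVProfile L u u₁ u₂ g) :
    ∫ x in (0 : ℝ)..L, u₁ x * (x * u x) = -(1 / 2) * ∫ x in (0 : ℝ)..L, u x ^ 2 := by
  have c1 := h.continuous
  have c2 := h.continuous₁
  have e := intervalIntegral.integral_eq_sub_of_hasDerivAt (a := 0) (b := L)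
    (f := fun x => x * u x ^ 2 / 2)
    (f' := fun x => u₁ x * (x * u x) + 1 / 2 * u x ^ 2) (fun x _ => by
      refine (((hasDerivAt_id x).mul ((h.hasDerivAt x).pow 2)).div_const 2).congr_deriv ?_
      simp
      ring) ((by fun_prop : Continuous _).intervalIntegrable _ _)
  rw [intervalIntegral.integral_add ((by fun_prop : Continuous _).intervalIntegrable _ _)
    ((by fun_prop : Continuous _).intervalIntegrable _ _),
    intervalIntegral.integral_const_mul, h.right] at e
  linarith

/-- The source of the smoothing: the weight `x` removes the trace of `u'` at `0`, and commuting it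
with the third derivative leaves a positive multiple of `∫ u'²`. -/
theorem integral_third_mul_weight (hL : 0 ≤ L) (h : IsKdVProfile L u u₁ u₂ g) :
    ∫ x in (0 : ℝ)..L, g x * (x * u x) = 3 / 2 * ∫ x in (0 : ℝ)..L, u₁ x ^ 2 := by
  have c0 := h.continuous
  have c1 := h.continuous₁
  have c2 := h.continuous₂
  have e1 := intervalIntegral.integral_eq_sub_of_hasDerivAt (a := 0) (b := L)
    (f := fun x => u₁ x * u x + x * u₁ x ^ 2 / 2)
    (f' := fun x => u₂ x * (u x + x * u₁ x) + 3 / 2 * u₁ x ^ 2) (fun x _ => by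
      refine (((h.hasDerivAt₁ x).mul (h.hasDerivAt x)).add
        (((hasDerivAt_id x).mul ((h.hasDerivAt₁ x).pow 2)).div_const 2)).congr_deriv ?_
      simp
      ring) ((by fun_prop : Continuous _).intervalIntegrable _ _)
  rw [intervalIntegral.integral_add ((by fun_prop : Continuous _).intervalIntegrable _ _)
    ((by fun_prop : Continuous _).intervalIntegrable _ _),
    intervalIntegral.integral_const_mul, h.right, h.left, h.right₁] at e1
  have e2 := integral_mul_eq_of_primitive hL (L2.intervalIntegrable hL g) h.eq₂
    (v := fun x => x * u x) (v' := fun x => u x + x * u₁ x)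
    (fun x => ((hasDerivAt_id x).mul (h.hasDerivAt x)).congr_deriv (by simp)) (by fun_prop)
  rw [e2, h.right]
  linarith

theorem sq_le (hL : 0 < L) (h : IsKdVProfile L u u₁ u₂ g) {x : ℝ} (hx : x ∈ Icc 0 L) :
    u x ^ 2 ≤ L * ∫ x in (0 : ℝ)..L, u₁ x ^ 2 := by
  have c1 := h.continuous₁
  have e := eq_add_integral_of_hasDerivAt h.hasDerivAt h.continuous₁ x
  rw [h.left, zero_add] at e
  -- The optimal constant in `2 k u(x) ≤ L k² + ∫ u'²`, which replaces Cauchy-Schwarz.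
  set k := u x / L with hk
  have h1 : ∫ t in (0 : ℝ)..x, 2 * k * u₁ t ≤ ∫ t in (0 : ℝ)..x, (k ^ 2 + u₁ t ^ 2) := by
    refine intervalIntegral.integral_mono_on hx.1
      ((by fun_prop : Continuous _).intervalIntegrable _ _)
      ((by fun_prop : Continuous _).intervalIntegrable _ _) fun t _ => ?_
    nlinarith [sq_nonneg (k - u₁ t)]
  have h2 : ∫ t in (0 : ℝ)..x, (k ^ 2 + u₁ t ^ 2) ≤ ∫ t in (0 : ℝ)..L, (k ^ 2 + u₁ t ^ 2) :=
    intervalIntegral.integral_mono_interval le_rfl hx.1 hx.2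
      (ae_of_all _ fun t => by positivity) ((by fun_prop : Continuous _).intervalIntegrable _ _)
  rw [intervalIntegral.integral_const_mul, ← e] at h1
  have h4 : ∫ t in (0 : ℝ)..L, (k ^ 2 + u₁ t ^ 2) =
      L * k ^ 2 + ∫ t in (0 : ℝ)..L, u₁ t ^ 2 := by
    rw [intervalIntegral.integral_add ((by fun_prop : Continuous _).intervalIntegrable _ _)
      ((by fun_prop : Continuous _).intervalIntegrable _ _), intervalIntegral.integral_const,
      sub_zero, smul_eq_mul]
  have h3 : u x = k * L := by rw [hk]; field_simp
  rw [h3] at h1 ⊢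
  have h5 : L * k ^ 2 ≤ ∫ t in (0 : ℝ)..L, u₁ t ^ 2 := by linarith
  calc (k * L) ^ 2 = L * (L * k ^ 2) := by ring
    _ ≤ _ := by gcongr

end IsKdVProfile

/-! ### Multiplication by `x`, dissipativity and Kato smoothing. -/

theorem memLp_mulX (f : L2 L) :
    MemLp (fun x => x * f x) 2 (volume.restrict (Ioo (0 : ℝ) L)) :=
  (Lp.memLp f).of_le_mul (c := |L|)
    (continuous_id.aestronglyMeasurable.mul (Lp.aestronglyMeasurable f)) (by
      filter_upwards [ae_restrict_mem measurableSet_Ioo] with x hx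
      rw [norm_mul, Real.norm_eq_abs x, abs_of_pos hx.1]
      gcongr
      exact hx.2.le.trans (le_abs_self L))

/-- Multiplication by the coordinate `x` on `L²(0, L)`. -/
noncomputable def mulX (L : ℝ) : L2 L →L[ℝ] L2 L :=
  LinearMap.mkContinuous
    { toFun := fun f => (memLp_mulX f).toLp
      map_add' := fun f g => by
        refine Lp.ext ?_
        filter_upwards [(memLp_mulX (f + g)).coeFn_toLp,
          Lp.coeFn_add (memLp_mulX f).toLp (memLp_mulX g).toLp,
          (memLp_mulX f).coeFn_toLp, (memLp_mulX g).coeFn_toLp, Lp.coeFn_add f g]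
          with x h1 h2 h3 h4 h5
        rw [h1, h2, Pi.add_apply, h3, h4, h5, Pi.add_apply, mul_add]
      map_smul' := fun c f => by
        refine Lp.ext ?_
        filter_upwards [(memLp_mulX (c • f)).coeFn_toLp, Lp.coeFn_smul c (memLp_mulX f).toLp,
          (memLp_mulX f).coeFn_toLp, Lp.coeFn_smul c f] with x h1 h2 h3 h4
        rw [h1, RingHom.id_apply, h2, Pi.smul_apply, h3, h4, Pi.smul_apply, smul_eq_mul,
          smul_eq_mul, mul_left_comm] }
    |L| fun f => Lp.norm_le_mul_norm_of_ae_le_mul (by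
      filter_upwards [(memLp_mulX f).coeFn_toLp, ae_restrict_mem measurableSet_Ioo] with x h1 hx
      simp only [LinearMap.coe_mk, AddHom.coe_mk]
      rw [h1, norm_mul, Real.norm_eq_abs x, abs_of_pos hx.1]
      gcongr
      exact hx.2.le.trans (le_abs_self L))

theorem mulX_coeFn (f : L2 L) :
    mulX L f =ᵐ[volume.restrict (Ioo (0 : ℝ) L)] fun x => x * f x :=
  (memLp_mulX f).coeFn_toLp

theorem L2.inner_eq (f g : L2 L) : inner ℝ f g = ∫ x in Ioo (0 : ℝ) L, f x * g x := by
  rw [L2.inner_def]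
  refine integral_congr_ae (ae_of_all _ fun x => ?_)
  simp [mul_comm]

theorem L2.norm_sq_eq (f : L2 L) : ‖f‖ ^ 2 = ∫ x in Ioo (0 : ℝ) L, f x ^ 2 := by
  rw [← real_inner_self_eq_norm_sq, L2.inner_eq]
  simp only [sq]

theorem mulX_symm (f g : L2 L) : inner ℝ (mulX L f) g = inner ℝ f (mulX L g) := by
  rw [L2.inner_eq, L2.inner_eq]
  refine integral_congr_ae ?_
  filter_upwards [mulX_coeFn f, mulX_coeFn g] with x h1 h2
  rw [h1, h2]
  ring

theorem inner_mulX_nonneg (f : L2 L) : 0 ≤ inner ℝ f (mulX L f) := by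
  rw [L2.inner_eq]
  refine integral_nonneg_of_ae ?_
  filter_upwards [mulX_coeFn f, ae_restrict_mem measurableSet_Ioo] with x h1 hx
  rw [h1, Pi.zero_apply, show f x * (x * f x) = x * f x ^ 2 by ring]
  exact mul_nonneg hx.1.le (sq_nonneg _)

theorem norm_mulX_le (f : L2 L) : ‖mulX L f‖ ≤ L * ‖f‖ := by
  refine Lp.norm_le_mul_norm_of_ae_le_mul ?_
  filter_upwards [mulX_coeFn f, ae_restrict_mem measurableSet_Ioo] with x h1 hx
  rw [h1, norm_mul, Real.norm_eq_abs x, abs_of_pos hx.1]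
  gcongr
  exact hx.2.le

theorem inner_profile (hL : 0 ≤ L) {u u₁ u₂ : ℝ → ℝ} {g : L2 L} (h : IsKdVProfile L u u₁ u₂ g)
    {w y : L2 L} {v : ℝ → ℝ} (hv : Continuous v)
    (hw : w =ᵐ[volume.restrict (Ioo (0 : ℝ) L)] fun x => -u₁ x - g x)
    (hy : y =ᵐ[volume.restrict (Ioo (0 : ℝ) L)] v) :
    inner ℝ w y = -(∫ x in (0 : ℝ)..L, u₁ x * v x) - ∫ x in (0 : ℝ)..L, g x * v x := by
  have c1 := h.continuous₁
  rw [← intervalIntegral.integral_neg, ← intervalIntegral.integral_sub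
    ((by fun_prop : Continuous _).intervalIntegrable _ _)
    ((L2.intervalIntegrable hL g).mul_continuousOn hv.continuousOn), ← setIntegral_Ioo_eq hL,
    L2.inner_eq]
  refine integral_congr_ae ?_
  filter_upwards [hw, hy] with x h1 h2
  rw [h1, h2]
  ring

theorem KdVOperator.inner_nonpos (hL : 0 < L) {z w : L2 L} (h : KdVOperator L z w) :
    inner ℝ w z ≤ 0 := by
  obtain ⟨u, u₁, u₂, g, hu, hz, hw⟩ := h.exists_profile hL
  rw [inner_profile hL.le hu hu.continuous hw hz, hu.integral_mul_self,
    hu.integral_third_mul hL.le]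
  have := sq_nonneg (u₁ 0)
  linarith

/-- Kato smoothing: the multiplier `x z` controls the supremum of `z ∈ D(A)`. -/
theorem KdVOperator.sq_le (hL : 0 < L) {z w : L2 L} (h : KdVOperator L z w) :
    ∀ᵐ x ∂volume.restrict (Ioo (0 : ℝ) L),
      z x ^ 2 ≤ L / 3 * (‖z‖ ^ 2 - 2 * inner ℝ w (mulX L z)) := by
  obtain ⟨u, u₁, u₂, g, hu, hz, hw⟩ := h.exists_profile hL
  have hm : mulX L z =ᵐ[volume.restrict (Ioo (0 : ℝ) L)] fun x => x * u x := by
    filter_upwards [mulX_coeFn z, hz] with x h1 h2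
    rw [h1, h2]
  have hn : ‖z‖ ^ 2 = ∫ x in (0 : ℝ)..L, u x ^ 2 := by
    rw [L2.norm_sq_eq, ← setIntegral_Ioo_eq hL.le]
    refine integral_congr_ae ?_
    filter_upwards [hz] with x h1
    rw [h1]
  have hc := hu.continuous
  -- Here `⟨w, x z⟩ = ½ ∫ u² - (3/2) ∫ u'²`, so the bracket equals `3 ∫ u'²`.
  rw [inner_profile hL.le hu (by fun_prop) hw hm, hn, hu.integral_mul_weight,
    hu.integral_third_mul_weight hL.le]
  filter_upwards [hz, ae_restrict_mem measurableSet_Ioo] with x h1 hx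
  rw [h1]
  have := hu.sq_le hL (Ioo_subset_Icc_self hx)
  linarith

end Operator

end KdVISS

namespace KdVISS

/-! ### Surjectivity of `l - A` by shooting. -/

section Range

/-- Linear differential equations with constant coefficients and a continuous right-hand side have
global solutions. -/
theorem exists_linear_ode_solution {E : Type*} [NormedAddCommGroup E] [NormedSpace ℝ E]
    [CompleteSpace E] (M : E →L[ℝ] E) {G : ℝ → E} (hG : Continuous G) (x₀ : ℝ) (v : E) :
    ∃ U : ℝ → E, U x₀ = v ∧ ∀ x, HasDerivAt U (M (U x) + G x) x := by
  -- Variation of constants: `Q` is the fundamental solution and `P` its pointwise inverse.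
  let Q : ℝ → E →L[ℝ] E := fun x => NormedSpace.exp ((x - x₀) • M)
  let P : ℝ → E →L[ℝ] E := fun x => NormedSpace.exp ((x₀ - x) • M)
  have hQ : ∀ x, HasDerivAt Q (M * Q x) x := fun x => by
    have := (hasDerivAt_exp_smul_const' (𝕂 := ℝ) M (x - x₀)).scomp x
      ((hasDerivAt_id x).sub_const x₀)
    rw [one_smul] at this
    exact this
  have hPc : Continuous P := by
    have h : ∀ x, HasDerivAt P ((-1 : ℝ) • (M * P x)) x := fun x =>
      (hasDerivAt_exp_smul_const' (𝕂 := ℝ) M (x₀ - x)).scomp x ((hasDerivAt_id x).const_sub x₀)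
    exact continuous_iff_continuousAt.2 fun x => (h x).continuousAt
  have hQP : ∀ x, Q x * P x = 1 := fun x => by
    let : NormedAlgebra ℚ (E →L[ℝ] E) := .restrictScalars ℚ ℝ _
    rw [← NormedSpace.exp_add_of_commute (((Commute.refl M).smul_left _).smul_right _),
      ← add_smul]
    simp
  have hc : Continuous fun s => P s (G s) := hPc.clm_apply hG
  refine ⟨fun x => Q x (v + ∫ s in x₀..x, P s (G s)), ?_, fun x => ?_⟩
  · simp [Q]
  · have h1 : HasDerivAt (fun x => v + ∫ s in x₀..x, P s (G s)) (P x (G x)) x :=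
      (intervalIntegral.integral_hasDerivAt_right (hc.intervalIntegrable _ _)
        (hc.stronglyMeasurableAtFilter _ _) hc.continuousAt).const_add v
    refine ((hQ x).clm_apply h1).congr_deriv ?_
    have := congrArg (fun S : E →L[ℝ] E => S (G x)) (hQP x)
    simp only [mul_apply_eq_comp, one_apply_eq_self] at this
    rw [this, mul_apply_eq_comp]

/-- The companion matrix of `u''' = - l u - u'`. -/
noncomputable def companion (l : ℝ) : ℝ × ℝ × ℝ →L[ℝ] ℝ × ℝ × ℝ :=
  ((ContinuousLinearMap.fst ℝ ℝ ℝ).comp (ContinuousLinearMap.snd ℝ ℝ (ℝ × ℝ))).prod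
    (((ContinuousLinearMap.snd ℝ ℝ ℝ).comp (ContinuousLinearMap.snd ℝ ℝ (ℝ × ℝ))).prod
      (-(l • ContinuousLinearMap.fst ℝ ℝ (ℝ × ℝ)) -
        (ContinuousLinearMap.fst ℝ ℝ ℝ).comp (ContinuousLinearMap.snd ℝ ℝ (ℝ × ℝ))))

theorem companion_apply (l a b c : ℝ) : companion l (a, b, c) = (b, c, -(l * a) - b) := rfl

/-- `(u, p, q)` solves `u' = p`, `p' = q + F`, `q' = - l u - p`, vanishing together with its
derivative at `L`. -/
theorem exists_system_solution (l L : ℝ) {F : ℝ → ℝ} (hF : Continuous F) (c : ℝ) :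
    ∃ u p q : ℝ → ℝ, (∀ x, HasDerivAt u (p x) x) ∧ (∀ x, HasDerivAt p (q x + F x) x) ∧
      (∀ x, HasDerivAt q (-(l * u x) - p x) x) ∧ u L = 0 ∧ p L = 0 ∧ q L = c := by
  obtain ⟨U, hU0, hU⟩ := exists_linear_ode_solution (companion l)
    (G := fun x => ((0 : ℝ), F x, (0 : ℝ))) (by fun_prop) L (0, 0, c)
  have hU' : ∀ x, HasDerivAt U ((U x).2.1, (U x).2.2 + F x, -(l * (U x).1) - (U x).2.1) x := by
    intro x
    refine (hU x).congr_deriv ?_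
    rw [show U x = ((U x).1, (U x).2.1, (U x).2.2) from rfl, companion_apply]
    simp
  refine ⟨fun x => (U x).1, fun x => (U x).2.1, fun x => (U x).2.2, fun x => ?_, fun x => ?_,
    fun x => ?_, ?_, ?_, ?_⟩
  · exact hasFDerivAt_fst.comp_hasDerivAt x (hU' x)
  · exact (hasFDerivAt_fst (𝕜 := ℝ)).comp_hasDerivAt x
      (hasFDerivAt_snd.comp_hasDerivAt x (hU' x))
  · exact (hasFDerivAt_snd (𝕜 := ℝ)).comp_hasDerivAt x
      (hasFDerivAt_snd.comp_hasDerivAt x (hU' x))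
  · simp [hU0]
  · simp [hU0]
  · simp [hU0]

/-- A pointwise form of dissipativity: `Ψ = u² / 2 + u u'' - u'² / 2` has derivative `-l u²` and
vanishes at `L`. If `u 0 = 0`, then `Ψ 0 ≤ 0`, so the nonincreasing `Ψ` is zero on `(0, L)`; hence
so are `u` and `u''`, against `u''(L) = 1`. -/
theorem homogeneous_left_ne_zero {l L : ℝ} (hl : 0 < l) (hL : 0 < L) {u p q : ℝ → ℝ}
    (hu : ∀ x, HasDerivAt u (p x) x) (hp : ∀ x, HasDerivAt p (q x) x)
    (hq : ∀ x, HasDerivAt q (-(l * u x) - p x) x) (huL : u L = 0) (hpL : p L = 0)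
    (hqL : q L = 1) : u 0 ≠ 0 := by
  intro hu0
  set Ψ : ℝ → ℝ := fun x => u x ^ 2 / 2 + u x * q x - p x ^ 2 / 2 with hΨ
  have hd : ∀ x, HasDerivAt Ψ (-(l * u x ^ 2)) x := fun x => by
    refine (((((hu x).pow 2).div_const 2).add ((hu x).mul (hq x))).sub
      (((hp x).pow 2).div_const 2)).congr_deriv ?_
    simp
    ring
  have ha : Antitone Ψ := antitone_of_deriv_nonpos (fun x => (hd x).differentiableAt) fun x => by
    rw [(hd x).deriv]
    have := mul_nonneg hl.le (sq_nonneg (u x))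
    linarith
  have hΨL : Ψ L = 0 := by simp [hΨ, huL, hpL]
  have hΨ0 : Ψ 0 ≤ 0 := by
    simp only [hΨ, hu0]
    nlinarith [sq_nonneg (p 0)]
  have hΨz : ∀ x ∈ Ioo 0 L, Ψ x = 0 := fun x hx =>
    le_antisymm ((ha hx.1.le).trans hΨ0) (hΨL ▸ ha hx.2.le)
  have hderiv : ∀ {v v' : ℝ → ℝ}, (∀ x, HasDerivAt v (v' x) x) → (∀ x ∈ Ioo 0 L, v x = 0) →
      ∀ x ∈ Ioo 0 L, v' x = 0 := by
    intro v v' hv hz x hx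
    refine (hv x).unique ((hasDerivAt_const x (0 : ℝ)).congr_of_eventuallyEq ?_)
    filter_upwards [isOpen_Ioo.mem_nhds hx] with y hy
    exact hz y hy
  have huz : ∀ x ∈ Ioo 0 L, u x = 0 := fun x hx => by
    have := hderiv hd hΨz x hx
    rw [neg_eq_zero, mul_eq_zero, or_iff_right hl.ne'] at this
    exact pow_eq_zero_iff two_ne_zero |>.1 this
  have hqz := hderiv hp (hderiv hu huz)
  have hev : ∀ᶠ x in 𝓝[<] L, (0 : ℝ) < q x := by
    have : Tendsto q (𝓝[<] L) (𝓝 1) := hqL ▸ (hq L).continuousAt.tendsto.mono_left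
      nhdsWithin_le_nhds
    exact this.eventually_const_lt one_pos
  obtain ⟨x, hx1, hx2⟩ := (hev.and (Ioo_mem_nhdsLT hL)).exists
  exact hx1.ne' (hqz x hx2)

theorem KdVOperator.range {L : ℝ} (hL : 0 < L) {l : ℝ} (hl : 0 < l) (f : L2 L) :
    ∃ z w, KdVOperator L z w ∧ l • z - w = f := by
  have hind : Integrable ((Ioo 0 L).indicator f) volume :=
    (integrable_indicator_iff measurableSet_Ioo).2 f.integrableOn
  have hFc : Continuous fun x => ∫ t in L..x, (Ioo 0 L).indicator f t :=
    hind.continuous_primitive L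
  -- As `f` is only square integrable, it enters through its continuous primitive, and `q = u'' - F`
  -- is the classical unknown: `q' = -l u - u'` encodes `l u + u' + u''' = f`.
  set F : ℝ → ℝ := fun x => ∫ t in L..x, (Ioo 0 L).indicator f t with hF
  obtain ⟨e, ep, eq, he, hep, heq, heL, hepL, heqL⟩ :=
    exists_system_solution l L (F := fun _ => 0) continuous_const 1
  simp only [add_zero] at hep
  have he0 := homogeneous_left_ne_zero hl hL he hep heq heL hepL heqL
  obtain ⟨s, sp, sq, hs, hsp, hsq, hsL, hspL, -⟩ := exists_system_solution l L hFc 0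
  -- Subtracting this multiple of the homogeneous solution restores `u 0 = 0` and keeps both
  -- conditions at `L`.
  set c := s 0 / e 0 with hc
  set u : ℝ → ℝ := fun x => s x - c * e x with hu
  set p : ℝ → ℝ := fun x => sp x - c * ep x with hp
  set q : ℝ → ℝ := fun x => sq x - c * eq x with hq
  have hud : ∀ x, HasDerivAt u (p x) x := fun x => (hs x).sub ((he x).const_mul c)
  have hpd : ∀ x, HasDerivAt p (q x + F x) x := fun x =>
    ((hsp x).sub ((hep x).const_mul c)).congr_deriv (by simp only [hq]; ring)
  have hqd : ∀ x, HasDerivAt q (-(l * u x) - p x) x := fun x =>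
    ((hsq x).sub ((heq x).const_mul c)).congr_deriv (by simp only [hu, hp]; ring)
  have huc : Continuous u := continuous_iff_continuousAt.2 fun x => (hud x).continuousAt
  have hpc : Continuous p := continuous_iff_continuousAt.2 fun x => (hpd x).continuousAt
  have hqc : Continuous q := continuous_iff_continuousAt.2 fun x => (hqd x).continuousAt
  have mu := memLp_of_continuous (L := L) huc
  have mp := memLp_of_continuous (L := L) hpc
  set z : L2 L := mu.toLp with hz
  set g : L2 L := f - l • z - mp.toLp with hg
  have hga : g =ᵐ[volume.restrict (Ioo (0 : ℝ) L)] fun x => f x - l * u x - p x := by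
    filter_upwards [Lp.coeFn_sub (f - l • z) mp.toLp, Lp.coeFn_sub f (l • z),
      Lp.coeFn_smul l z, mu.coeFn_toLp, mp.coeFn_toLp] with x h1 h2 h3 h4 h5
    rw [h1, Pi.sub_apply, h2, Pi.sub_apply, h3, Pi.smul_apply, h4, h5, smul_eq_mul]
  have prof : IsKdVProfile L u p (fun x => q x + F x) g := by
    refine ⟨hud, hpd, hqc.add hFc, fun x hx => ?_, ?_, ?_, ?_⟩
    · have h1 := eq_add_integral_of_hasDerivAt hqd (by fun_prop) x
      have h2 : F x = F 0 + ∫ t in (0 : ℝ)..x, (Ioo 0 L).indicator f t :=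
        (intervalIntegral.integral_add_adjacent_intervals hind.intervalIntegrable
          hind.intervalIntegrable).symm
      have h3 : ∫ t in (0 : ℝ)..x, g t =
          ∫ t in (0 : ℝ)..x, ((-(l * u t) - p t) + (Ioo 0 L).indicator f t) := by
        refine intervalIntegral.integral_congr_ae ?_
        have hne : ∀ᵐ t : ℝ, t ≠ L := Measure.ae_ne _ _
        filter_upwards [(ae_restrict_iff' measurableSet_Ioo).1 hga, hne] with t ht htL htI
        rw [uIoc_of_le hx.1] at htI
        have htm : t ∈ Ioo 0 L := ⟨htI.1, lt_of_le_of_ne (htI.2.trans hx.2) htL⟩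
        rw [ht htm, indicator_of_mem htm]
        ring
      rw [h3, intervalIntegral.integral_add
        ((by fun_prop : Continuous _).intervalIntegrable _ _) hind.intervalIntegrable]
      linarith
    · simp only [hu, hc]
      field_simp
      ring
    · simp [hu, hsL, heL]
    · simp [hp, hspL, hepL]
  refine ⟨z, l • z - f, prof.kdVOperator hL.le mu.coeFn_toLp ?_, by abel⟩
  filter_upwards [hga, Lp.coeFn_sub (l • z) f, Lp.coeFn_smul l z, mu.coeFn_toLp]
    with x h1 h2 h3 h4
  rw [h1, h2, Pi.sub_apply, h3, Pi.smul_apply, h4, smul_eq_mul]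
  ring

/-! ### Linearity of the graph, and the resolvent of the KdV operator. -/

theorem HasWeakDeriv.add {L : ℝ} {f g f' g' : L2 L} (h : HasWeakDeriv L f g)
    (h' : HasWeakDeriv L f' g') : HasWeakDeriv L (f + f') (g + g') := by
  intro φ hφ hφc hφs
  have hφ' := hφ.continuous_deriv (by simp)
  obtain ⟨C, hC⟩ := hφ.continuous.bounded_above_of_compact_support hφc
  obtain ⟨C', hC'⟩ := hφ'.bounded_above_of_compact_support hφc.deriv
  have i1 : ∀ k : L2 L, IntegrableOn (fun x => k x * φ x) (Ioo 0 L) volume := fun k =>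
    k.integrableOn.mul_bdd hφ.continuous.aestronglyMeasurable (ae_of_all _ hC)
  have i2 : ∀ k : L2 L, IntegrableOn (fun x => k x * deriv φ x) (Ioo 0 L) volume := fun k =>
    k.integrableOn.mul_bdd hφ'.aestronglyMeasurable (ae_of_all _ hC')
  have e1 : ∫ x in Ioo (0 : ℝ) L, (f + f') x * deriv φ x =
      (∫ x in Ioo (0 : ℝ) L, f x * deriv φ x) + ∫ x in Ioo (0 : ℝ) L, f' x * deriv φ x := by
    rw [← integral_add (i2 f) (i2 f')]
    refine integral_congr_ae ?_
    filter_upwards [Lp.coeFn_add f f'] with x hx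
    rw [hx, Pi.add_apply, add_mul]
  have e2 : ∫ x in Ioo (0 : ℝ) L, (g + g') x * φ x =
      (∫ x in Ioo (0 : ℝ) L, g x * φ x) + ∫ x in Ioo (0 : ℝ) L, g' x * φ x := by
    rw [← integral_add (i1 g) (i1 g')]
    refine integral_congr_ae ?_
    filter_upwards [Lp.coeFn_add g g'] with x hx
    rw [hx, Pi.add_apply, add_mul]
  rw [e1, e2, h φ hφ hφc hφs, h' φ hφ hφc hφs]
  ring

theorem HasWeakDeriv.smul {L : ℝ} {f g : L2 L} (h : HasWeakDeriv L f g) (c : ℝ) :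
    HasWeakDeriv L (c • f) (c • g) := by
  intro φ hφ hφc hφs
  have e : ∀ (k : L2 L) (v : ℝ → ℝ), ∫ x in Ioo (0 : ℝ) L, (c • k) x * v x =
      c * ∫ x in Ioo (0 : ℝ) L, k x * v x := by
    intro k v
    rw [← integral_const_mul]
    refine integral_congr_ae ?_
    filter_upwards [Lp.coeFn_smul c k] with x hx
    rw [hx, Pi.smul_apply, smul_eq_mul, mul_assoc]
  rw [e, e, h φ hφ hφc hφs, mul_neg]

theorem HasWeakDeriv.eq_zero {L : ℝ} {g : L2 L} (h : HasWeakDeriv L 0 g) : g = 0 := by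
  refine Lp.ext ?_
  have h0 := Lp.coeFn_zero ℝ 2 (volume.restrict (Ioo (0 : ℝ) L))
  filter_upwards [h0, ae_eq_zero_of_weak g.integrableOn fun φ hφ hφc hφs => by
    have h1 := h φ hφ hφc hφs
    have e : ∫ x in Ioo (0 : ℝ) L, (0 : L2 L) x * deriv φ x = 0 := by
      refine (integral_congr_ae (g := fun _ => 0) ?_).trans (by simp)
      filter_upwards [h0] with x hx
      rw [hx, Pi.zero_apply, zero_mul]
    rw [e] at h1
    linarith] with x hx hx'
  rw [hx', hx, Pi.zero_apply]

theorem IsContinuousRep.add {L : ℝ} {f f' : L2 L} {u u' : ℝ → ℝ} (h : IsContinuousRep L f u)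
    (h' : IsContinuousRep L f' u') : IsContinuousRep L (f + f') (u + u') :=
  ⟨h.1.add h'.1, (Lp.coeFn_add f f').trans (h.2.add h'.2)⟩

theorem IsContinuousRep.smul {L : ℝ} {f : L2 L} {u : ℝ → ℝ} (h : IsContinuousRep L f u) (c : ℝ) :
    IsContinuousRep L (c • f) (c • u) :=
  ⟨h.1.const_smul c, (Lp.coeFn_smul c f).trans (h.2.const_smul c)⟩

theorem KdVOperator.add {L : ℝ} {z w z' w' : L2 L} (h : KdVOperator L z w)
    (h' : KdVOperator L z' w') : KdVOperator L (z + z') (w + w') := by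
  obtain ⟨z₁, z₂, z₃, h1, h2, h3, ⟨v, hv, hv0, hvL⟩, ⟨v₁, hv₁, hv₁L⟩, rfl⟩ := h
  obtain ⟨z₁', z₂', z₃', h1', h2', h3', ⟨v', hv', hv0', hvL'⟩, ⟨v₁', hv₁', hv₁L'⟩, rfl⟩ := h'
  exact ⟨_, _, _, h1.add h1', h2.add h2', h3.add h3',
    ⟨_, hv.add hv', by simp [hv0, hv0'], by simp [hvL, hvL']⟩,
    ⟨_, hv₁.add hv₁', by simp [hv₁L, hv₁L']⟩, by abel⟩

theorem KdVOperator.smul {L : ℝ} {z w : L2 L} (h : KdVOperator L z w) (c : ℝ) :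
    KdVOperator L (c • z) (c • w) := by
  obtain ⟨z₁, z₂, z₃, h1, h2, h3, ⟨v, hv, hv0, hvL⟩, ⟨v₁, hv₁, hv₁L⟩, rfl⟩ := h
  exact ⟨_, _, _, h1.smul c, h2.smul c, h3.smul c,
    ⟨_, hv.smul c, by simp [hv0], by simp [hvL]⟩, ⟨_, hv₁.smul c, by simp [hv₁L]⟩, by module⟩

theorem KdVOperator.eq_zero {L : ℝ} {w : L2 L} (h : KdVOperator L 0 w) : w = 0 := by
  obtain ⟨z₁, z₂, z₃, h1, h2, h3, -, -, rfl⟩ := h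
  obtain rfl := h1.eq_zero
  obtain rfl := h2.eq_zero
  obtain rfl := h3.eq_zero
  simp

theorem KdVOperator.exists_resolvent {L : ℝ} (hL : 0 < L) :
    ∃ R : ℝ → L2 L →L[ℝ] L2 L, IsResolventOf (KdVOperator L) R :=
  exists_isResolventOf (fun _ _ _ _ h h' => h.add h') (fun c _ _ h => h.smul c)
    (fun _ _ h => h.inner_nonpos hL) (fun _ hl f => KdVOperator.range hL hl f)
    (fun _ h => h.eq_zero)

end Range

end KdVISS

namespace KdVISS

/-! ### Pointwise and integrated inequalities for the saturation. -/

section Saturation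

theorem satReal_of_le {a : ℝ} (h : a ≤ -1) : satReal a = -1 := if_pos h

theorem satReal_of_mem {a : ℝ} (h1 : -1 ≤ a) (h2 : a ≤ 1) : satReal a = a := by
  unfold satReal
  split_ifs <;> linarith

theorem satReal_of_ge {a : ℝ} (h : 1 ≤ a) : satReal a = 1 := by
  unfold satReal
  split_ifs <;> linarith

theorem abs_satReal_le_one (a : ℝ) : |satReal a| ≤ 1 := by
  rw [abs_le]
  unfold satReal
  split_ifs <;> constructor <;> linarith

theorem abs_satReal_le (a : ℝ) : |satReal a| ≤ |a| := by
  have h := lipschitzWith_satReal.dist_le_mul a 0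
  rwa [satReal_zero, NNReal.coe_one, one_mul, Real.dist_eq, Real.dist_eq, sub_zero, sub_zero] at h

theorem mul_satReal_nonneg (a : ℝ) : 0 ≤ satReal a * a := by
  unfold satReal
  split_ifs <;> nlinarith

theorem mul_satReal_le (a : ℝ) : satReal a * a ≤ a ^ 2 := by
  have h := mul_le_mul_of_nonneg_right (abs_satReal_le a) (abs_nonneg a)
  rw [← abs_mul, abs_of_nonneg (mul_satReal_nonneg a), ← sq, sq_abs] at h
  exact h

/-- Inside `[-1, 1]` one has `sat(a) a = a²`; outside, `a² = |a| (sat(a) a)` and `|a| ≤ 2 + a²`. The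
factor is quadratic in `a` because smoothing controls the square of the supremum. -/
theorem sq_le_mul_satReal (a : ℝ) : a ^ 2 ≤ (2 + a ^ 2) * (satReal a * a) := by
  rcases le_total a (-1) with h | h
  · rw [satReal_of_le h]
    nlinarith [sq_nonneg a, mul_nonneg (sq_nonneg a) (by linarith : (0 : ℝ) ≤ -a - 1)]
  rcases le_total a 1 with h' | h'
  · rw [satReal_of_mem h h']
    nlinarith [sq_nonneg a, sq_nonneg (a ^ 2)]
  · rw [satReal_of_ge h']
    nlinarith [sq_nonneg a, mul_nonneg (sq_nonneg a) (by linarith : (0 : ℝ) ≤ a - 1)]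

/-- If `|b| ≤ |a| / 2`, then `a + b` keeps the sign of `a` and at least half its size, so the
saturation loses at most a factor 2. Otherwise `|a| < 2 |b|`, and the terms `(|a| + |b|) |a| ≤ 6 b²`
and `a² / 2 ≤ 2 b²` add up to `8 b²`. -/
theorem mul_satReal_add_ge (a b : ℝ) :
    1 / 2 * (satReal a * a) - 8 * b ^ 2 ≤ satReal (a + b) * a := by
  rcases lt_or_ge |a| (2 * |b|) with h | h
  · have h1 := mul_satReal_le a
    have h2 : |satReal (a + b) * a| ≤ (|a| + |b|) * |a| := by
      rw [abs_mul]
      exact mul_le_mul_of_nonneg_right ((abs_satReal_le _).trans (abs_add_le a b)) (abs_nonneg a)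
    have h3 := neg_abs_le (satReal (a + b) * a)
    rw [← sq_abs a] at h1
    rw [← sq_abs b]
    nlinarith [abs_nonneg a, abs_nonneg b]
  · have hb := sq_nonneg b
    obtain ⟨hb1, hb2⟩ := abs_le.1 (show |b| ≤ |a| / 2 by linarith)
    rcases le_total 0 a with ha | ha
    · rw [abs_of_nonneg ha] at hb1 hb2
      have h4 : satReal a ≤ 2 * satReal (a + b) := by
        unfold satReal
        split_ifs <;> linarith
      nlinarith
    · rw [abs_of_nonpos ha] at hb1 hb2
      have h4 : 2 * satReal (a + b) ≤ satReal a := by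
        unfold satReal
        split_ifs <;> linarith
      nlinarith

variable {L : ℝ}

theorem lipschitzWith_sat (L : ℝ) : LipschitzWith 1 (sat L) :=
  lipschitzWith_satReal.lipschitzWith_compLp satReal_zero

theorem norm_sat_sq_le (hL : 0 ≤ L) (s : L2 L) : ‖sat L s‖ ^ 2 ≤ L := by
  rw [L2.norm_sq_eq]
  have h : ∫ x in Ioo (0 : ℝ) L, (sat L s x) ^ 2 ≤ ∫ _ in Ioo (0 : ℝ) L, (1 : ℝ) := by
    refine integral_mono_of_nonneg (ae_of_all _ fun x => sq_nonneg _) (integrable_const _) ?_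
    filter_upwards [sat_coeFn L s] with x hx
    rw [hx, ← sq_abs]
    exact pow_le_one₀ (abs_nonneg _) (abs_satReal_le_one _)
  refine h.trans_eq ?_
  simp [hL]

theorem norm_sat_le (hL : 0 ≤ L) (s : L2 L) : ‖sat L s‖ ≤ √L :=
  Real.le_sqrt_of_sq_le (norm_sat_sq_le hL s)

theorem L2.integrable_mul (f g : L2 L) :
    Integrable (fun x => f x * g x) (volume.restrict (Ioo (0 : ℝ) L)) :=
  (Lp.memLp f).integrable_mul (Lp.memLp g)

theorem L2.integrable_sq (f : L2 L) :
    Integrable (fun x => f x ^ 2) (volume.restrict (Ioo (0 : ℝ) L)) :=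
  (Lp.memLp f).integrable_sq

theorem inner_sat_nonneg (s : L2 L) : 0 ≤ inner ℝ (sat L s) s := by
  rw [L2.inner_eq]
  refine integral_nonneg_of_ae ?_
  filter_upwards [sat_coeFn L s] with x hx
  rw [hx]
  exact mul_satReal_nonneg _

theorem norm_sq_le_mul_inner_sat {s : L2 L} {S : ℝ}
    (hS : ∀ᵐ x ∂volume.restrict (Ioo (0 : ℝ) L), s x ^ 2 ≤ S) :
    ‖s‖ ^ 2 ≤ (2 + S) * inner ℝ (sat L s) s := by
  rw [L2.inner_eq, L2.norm_sq_eq, ← integral_const_mul]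
  refine integral_mono_ae (L2.integrable_sq _) ((L2.integrable_mul _ _).const_mul _) ?_
  filter_upwards [sat_coeFn L s, hS] with x hx hxS
  rw [hx]
  refine (sq_le_mul_satReal (s x)).trans ?_
  have := mul_satReal_nonneg (s x)
  gcongr

theorem inner_sat_add_ge (s e : L2 L) :
    1 / 2 * inner ℝ (sat L s) s - 8 * ‖e‖ ^ 2 ≤ inner ℝ (sat L (s + e)) s := by
  rw [L2.inner_eq, L2.norm_sq_eq, L2.inner_eq, ← integral_const_mul, ← integral_const_mul,
    ← integral_sub ((L2.integrable_mul _ _).const_mul _) ((L2.integrable_sq _).const_mul _)]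
  refine integral_mono_ae (((L2.integrable_mul _ _).const_mul _).sub
    ((L2.integrable_sq _).const_mul _)) (L2.integrable_mul _ _) ?_
  filter_upwards [sat_coeFn L s, sat_coeFn L (s + e), Lp.coeFn_add s e] with x h1 h2 h3
  rw [h1, h2, h3, Pi.add_apply]
  exact mul_satReal_add_ge _ _

/-- The quantity is `3 ∫ z'²`; its sign is read off the smoothing bound at any one point where that
bound holds. -/
theorem KdVOperator.nonneg (hL : 0 < L) {z w : L2 L} (h : KdVOperator L z w) :
    0 ≤ ‖z‖ ^ 2 - 2 * inner ℝ w (mulX L z) := by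
  have hne : NeBot (ae (volume.restrict (Ioo (0 : ℝ) L))) := by
    rw [ae_neBot, Ne, Measure.restrict_eq_zero]
    simp [hL]
  obtain ⟨x, hx⟩ := (h.sq_le hL).exists
  have h1 := (sq_nonneg (z x)).trans hx
  exact nonneg_of_mul_nonneg_right h1 (by positivity)

end Saturation

/-! ### Explicit comparison functions. -/

section Comparison

theorem isClassKInfty_const_mul {c : ℝ} (hc : 0 < c) : IsClassKInfty fun s => c * s where
  continuousOn := (continuous_const.mul continuous_id).continuousOn
  strictMonoOn := fun _ _ _ _ hab => mul_lt_mul_of_pos_left hab hc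
  zero := mul_zero c
  tendsto := tendsto_id.const_mul_atTop hc

/-- The decay rate `ν / (1 + r²)` decreases with `r`, so the exponential factor does not spoil
monotonicity in `r`. -/
theorem isClassKL_exp {c ν : ℝ} (hc : 0 < c) (hν : 0 < ν) :
    IsClassKL fun r t => c * r * Real.exp (-(ν * t / (1 + r ^ 2))) where
  continuousOn := by
    refine Continuous.continuousOn ?_
    have : ∀ p : ℝ × ℝ, 1 + p.1 ^ 2 ≠ 0 := fun p => by positivity
    fun_prop (disch := assumption)
  zero t _ := by simp
  strictMonoOn t ht a ha b hb hab := by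
    have ha : 0 ≤ a := ha
    have h1 : -(ν * t / (1 + a ^ 2)) ≤ -(ν * t / (1 + b ^ 2)) := by
      have : 0 ≤ ν * t := mul_nonneg hν.le ht
      rw [neg_le_neg_iff]
      gcongr
    have h2 := Real.exp_le_exp.2 h1
    calc c * a * Real.exp (-(ν * t / (1 + a ^ 2)))
        ≤ c * a * Real.exp (-(ν * t / (1 + b ^ 2))) := by gcongr
      _ < c * b * Real.exp (-(ν * t / (1 + b ^ 2))) := by
        have := Real.exp_pos (-(ν * t / (1 + b ^ 2)))
        gcongr
  strictAntiOn r hr _ _ _ _ hab := by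
    have h0 : 0 < c * r := mul_pos hc hr
    refine mul_lt_mul_of_pos_left (Real.exp_lt_exp.2 ?_) h0
    rw [neg_lt_neg_iff]
    gcongr
  tendsto r hr := by
    have h1 : Tendsto (fun t : ℝ => ν * t / (1 + r ^ 2)) atTop atTop :=
      (tendsto_id.const_mul_atTop hν).atTop_div_const (by positivity)
    have h2 := (Real.tendsto_exp_neg_atTop_nhds_zero.comp h1).const_mul (c * r)
    rwa [mul_zero] at h2

end Comparison

end KdVISS

namespace KdVISS

/-! ### A priori estimates, observability and decay along weak solutions. -/

section Estimates

theorem restrict_uIoc_le {a b : ℝ} (ha : 0 ≤ a) (hab : a ≤ b) :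
    (volume.restrict (uIoc a b) : Measure ℝ) ≤ volume.restrict (Ioi 0) := by
  rw [uIoc_of_le hab]
  exact Measure.restrict_mono (fun s hs => ha.trans_lt hs.1) le_rfl

theorem intervalIntegrable_of_bound_on {φ : ℝ → ℝ} {a b C : ℝ} (ha : 0 ≤ a) (hab : a ≤ b)
    (hm : AEStronglyMeasurable φ (volume.restrict (Ioi 0))) (hb : ∀ s ∈ Icc a b, ‖φ s‖ ≤ C) :
    IntervalIntegrable φ volume a b := by
  have h1 := hm.mono_measure (restrict_uIoc_le ha hab)
  rw [uIoc_of_le hab] at h1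
  rw [intervalIntegrable_iff_integrableOn_Ioc_of_le hab]
  refine Integrable.of_bound h1 C ?_
  filter_upwards [ae_restrict_mem measurableSet_Ioc] with s hs
  exact hb s ⟨hs.1.le, hs.2⟩

theorem tendsto_intervalIntegral_of_bound {Φ : ℝ → ℝ → ℝ} {φ : ℝ → ℝ} {a b C : ℝ} (ha : 0 ≤ a)
    (hab : a ≤ b) (hm : ∀ l, AEStronglyMeasurable (Φ l) (volume.restrict (Ioi 0)))
    (hb : ∀ l, 0 < l → ∀ s ∈ Icc a b, ‖Φ l s‖ ≤ C)
    (hl : ∀ s ∈ Icc a b, Tendsto (fun l => Φ l s) atTop (𝓝 (φ s))) :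
    Tendsto (fun l => ∫ s in a..b, Φ l s) atTop (𝓝 (∫ s in a..b, φ s)) := by
  have hI : ∀ s ∈ uIoc a b, s ∈ Icc a b := fun s hs => by
    rw [uIoc_of_le hab] at hs
    exact ⟨hs.1.le, hs.2⟩
  refine intervalIntegral.tendsto_integral_filter_of_dominated_convergence (fun _ => C)
    (Eventually.of_forall fun l => (hm l).mono_measure (restrict_uIoc_le ha hab)) ?_
    intervalIntegrable_const (ae_of_all _ fun s hs => hl s (hI s hs))
  filter_upwards [eventually_gt_atTop 0] with l hl0
  exact ae_of_all _ fun s hs => hb l hl0 s (hI s hs)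

theorem norm_inner_le_of_le {H : Type*} [NormedAddCommGroup H] [InnerProductSpace ℝ H] {x y : H}
    {a b : ℝ} (hx : ‖x‖ ≤ a) (hy : ‖y‖ ≤ b) : ‖inner ℝ x y‖ ≤ a * b :=
  (norm_inner_le_norm x y).trans
    (mul_le_mul hx hy (norm_nonneg _) ((norm_nonneg _).trans hx))

variable {L : ℝ} {T R : ℝ → L2 L →L[ℝ] L2 L} {d : Disturbance (L2 L)} {z₀ : L2 L} {z : ℝ → L2 L}

/-- The feedback `- sat (z + d)` along a trajectory. -/
noncomputable def feedback (L : ℝ) (d : Disturbance (L2 L)) (z : ℝ → L2 L) (s : ℝ) : L2 L :=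
  -sat L (z s + d s)

theorem norm_feedback_sq_le (hL : 0 ≤ L) (s : ℝ) : ‖feedback L d z s‖ ^ 2 ≤ L := by
  rw [feedback, norm_neg]
  exact norm_sat_sq_le hL _

theorem norm_feedback_le (hL : 0 ≤ L) (s : ℝ) : ‖feedback L d z s‖ ≤ √L :=
  Real.le_sqrt_of_sq_le (norm_feedback_sq_le hL s)

namespace IsWeakSolution

theorem aestronglyMeasurable (h : IsWeakSolution T (sat L) d z₀ z) :
    AEStronglyMeasurable z (volume.restrict (Ioi 0)) :=
  (h.continuousOn.mono Ioi_subset_Ici_self).aestronglyMeasurable measurableSet_Ioi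

theorem aestronglyMeasurable_feedback (h : IsWeakSolution T (sat L) d z₀ z) :
    AEStronglyMeasurable (feedback L d z) (volume.restrict (Ioi 0)) :=
  ((lipschitzWith_sat L).continuous.comp_aestronglyMeasurable
    (h.aestronglyMeasurable.add (Lp.aestronglyMeasurable d))).neg

theorem eq_feedback (h : IsWeakSolution T (sat L) d z₀ z) (t : ℝ) (ht : 0 ≤ t) :
    z t = T t z₀ + ∫ s in (0 : ℝ)..t, T (t - s) (feedback L d z s) := by
  rw [h.eq t ht, sub_eq_add_neg, ← intervalIntegral.integral_neg]
  simp only [feedback, map_neg]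

theorem apply_zero (hTc : IsContractionSemigroup T) (h : IsWeakSolution T (sat L) d z₀ z) :
    z 0 = z₀ := by
  rw [h.eq 0 le_rfl, intervalIntegral.integral_same, sub_zero, hTc.apply_zero]

end IsWeakSolution

theorem intervalIntegrable_norm_sq (d : Disturbance (L2 L)) {a b : ℝ} (ha : 0 ≤ a)
    (hab : a ≤ b) : IntervalIntegrable (fun s => ‖d s‖ ^ 2) volume a b := by
  have h : Integrable (fun s => ‖d s‖ ^ 2) (volume.restrict (Ioi (0 : ℝ))) :=
    (Lp.memLp d).integrable_norm_pow two_ne_zero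
  rw [intervalIntegrable_iff]
  exact h.mono_measure (restrict_uIoc_le ha hab)

theorem integral_norm_sq_le (d : Disturbance (L2 L)) {t : ℝ} (ht : 0 ≤ t) :
    ∫ s in (0 : ℝ)..t, ‖d s‖ ^ 2 ≤ ‖d‖ ^ 2 := by
  have h : Integrable (fun s => ‖d s‖ ^ 2) (volume.restrict (Ioi (0 : ℝ))) :=
    (Lp.memLp d).integrable_norm_pow two_ne_zero
  have e : ‖d‖ ^ 2 = ∫ s in Ioi (0 : ℝ), ‖d s‖ ^ 2 := by
    rw [← real_inner_self_eq_norm_sq, L2.inner_def]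
    simp only [real_inner_self_eq_norm_sq]
  rw [e, intervalIntegral.integral_of_le ht]
  exact setIntegral_mono_set h (ae_of_all _ fun s => by positivity)
    (Eventually.of_forall fun s hs => hs.1)

section

variable (hL : 0 < L) (hR : IsResolventOf (KdVOperator L) R)
  (hT : ∀ t, 0 ≤ t → ∀ x, Tendsto (fun l => yosidaExp R l t x) atTop (𝓝 (T t x)))
  (h : IsWeakSolution T (sat L) d z₀ z)
include hL hR hT h

theorem regularized_identity {S : L2 L →L[ℝ] L2 L}
    (hS : ∀ x y, inner ℝ (S x) y = inner ℝ x (S y)) {l : ℝ} (hl : 0 < l)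
    {a b : ℝ} (ha : 0 ≤ a) (hab : a ≤ b) :
    inner ℝ (l • R l (z b)) (S (l • R l (z b))) - inner ℝ (l • R l (z a)) (S (l • R l (z a))) =
      ∫ s in a..b, 2 * inner ℝ (yosida R l (z s) + l • R l (feedback L d z s))
        (S (l • R l (z s))) :=
  mild_energy_identity (J := l • R l) (B := yosida R l)
    (hR.limit_isContractionSemigroup hT)
    (fun r hr x => by
      change l • R l (T r x) = T r (l • R l x)
      rw [map_smul, hR.limit_comm hT hl hr])
    (fun r hr x => hR.norm_limit_sub_self_le hT (hR.smul_mem_graph hl x) hr)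
    (fun x => hR.limit_hasDeriv hT (hR.smul_mem_graph hl x))
    h.aestronglyMeasurable_feedback (norm_feedback_le hL.le) h.eq_feedback h.continuousOn hS ha hab

/-- In the identity with `S = id`, the term `⟨A y, y⟩ ≤ 0` is dropped before `l → ∞`; then `-2 ⟨sat
(z + d), z⟩ ≤ 16 ‖d‖² - ⟨sat z, z⟩`. -/
theorem energy_le {a b : ℝ} (ha : 0 ≤ a) (hab : a ≤ b) :
    ‖z b‖ ^ 2 + ∫ s in a..b, inner ℝ (sat L (z s)) (z s) ≤
      ‖z a‖ ^ 2 + 16 * ∫ s in a..b, ‖d s‖ ^ 2 := by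
  obtain ⟨K, hK⟩ := (isCompact_Icc (a := a) (b := b)).exists_bound_of_continuousOn
    (h.continuousOn.mono fun s hs => ha.trans hs.1)
  set f := feedback L d z with hf
  have hzm := h.aestronglyMeasurable
  have hfm := h.aestronglyMeasurable_feedback
  have hJm : ∀ l, AEStronglyMeasurable (fun s => l • R l (z s)) (volume.restrict (Ioi 0)) :=
    fun l => (l • R l).continuous.comp_aestronglyMeasurable hzm
  have hJfm : ∀ l, AEStronglyMeasurable (fun s => l • R l (f s)) (volume.restrict (Ioi 0)) :=
    fun l => (l • R l).continuous.comp_aestronglyMeasurable hfm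
  have hJz : ∀ l, 0 < l → ∀ s ∈ Icc a b, ‖l • R l (z s)‖ ≤ K := fun l hl s hs =>
    (hR.norm_smul_le hl _).trans (hK s hs)
  have hJf : ∀ l, 0 < l → ∀ s, ‖l • R l (f s)‖ ≤ √L := fun l hl s =>
    (hR.norm_smul_le hl _).trans (norm_feedback_le hL.le s)
  have hlim : Tendsto (fun l => ∫ s in a..b, inner ℝ (l • R l (f s)) (l • R l (z s))) atTop
      (𝓝 (∫ s in a..b, inner ℝ (f s) (z s))) :=
    tendsto_intervalIntegral_of_bound ha hab (fun l => (hJfm l).inner (hJm l))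
      (fun l hl s hs => norm_inner_le_of_le (hJf l hl s) (hJz l hl s hs))
      (fun s _ => (hR.tendsto_smul _).inner (hR.tendsto_smul _))
  have hreg : ∀ l, 0 < l → ‖l • R l (z b)‖ ^ 2 - ‖l • R l (z a)‖ ^ 2 ≤
      2 * ∫ s in a..b, inner ℝ (l • R l (f s)) (l • R l (z s)) := by
    intro l hl
    have e := regularized_identity hL hR hT h (S := ContinuousLinearMap.id ℝ _)
      (fun x y => rfl) hl ha hab
    simp only [ContinuousLinearMap.id_apply, real_inner_self_eq_norm_sq] at e
    rw [e, ← intervalIntegral.integral_const_mul]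
    have hBm := (yosida R l).continuous.comp_aestronglyMeasurable hzm
    refine intervalIntegral.integral_mono_on hab ?_ ?_ fun s hs => ?_
    · refine IntervalIntegrable.const_mul (intervalIntegrable_of_bound_on
        (C := (‖yosida R l‖ * K + √L) * K) ha hab ((hBm.add (hJfm l)).inner (hJm l))
        fun s hs => norm_inner_le_of_le ?_ (hJz l hl s hs)) 2
      exact (norm_add_le _ _).trans (add_le_add ((yosida R l).le_opNorm_of_le (hK s hs))
        (hJf l hl s))
    · exact IntervalIntegrable.const_mul (intervalIntegrable_of_bound_on ha hab
        ((hJfm l).inner (hJm l))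
        fun s hs => norm_inner_le_of_le (hJf l hl s) (hJz l hl s hs)) 2
    · rw [inner_add_left]
      have := (hR.smul_mem_graph hl (z s)).inner_nonpos hL
      linarith
  have hle : ‖z b‖ ^ 2 - ‖z a‖ ^ 2 ≤ 2 * ∫ s in a..b, inner ℝ (f s) (z s) := by
    refine le_of_tendsto_of_tendsto (((hR.tendsto_smul (z b)).norm.pow 2).sub
      ((hR.tendsto_smul (z a)).norm.pow 2)) (hlim.const_mul 2) ?_
    filter_upwards [eventually_gt_atTop 0] with l hl
    exact hreg l hl
  have hDi : IntervalIntegrable (fun s => inner ℝ (sat L (z s)) (z s)) volume a b :=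
    intervalIntegrable_of_bound_on ha hab
      (((lipschitzWith_sat L).continuous.comp_aestronglyMeasurable hzm).inner hzm)
      fun s hs => norm_inner_le_of_le (norm_sat_le hL.le _) (hK s hs)
  have hdi := intervalIntegrable_norm_sq d ha hab
  have hfi : IntervalIntegrable (fun s => inner ℝ (f s) (z s)) volume a b :=
    intervalIntegrable_of_bound_on ha hab (hfm.inner hzm)
      fun s hs => norm_inner_le_of_le (norm_feedback_le hL.le s) (hK s hs)
  have hfin : 2 * ∫ s in a..b, inner ℝ (f s) (z s) ≤
      ∫ s in a..b, (16 * ‖d s‖ ^ 2 - inner ℝ (sat L (z s)) (z s)) := by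
    rw [← intervalIntegral.integral_const_mul]
    refine intervalIntegral.integral_mono_on hab (hfi.const_mul 2)
      ((hdi.const_mul 16).sub hDi) fun s _ => ?_
    have := inner_sat_add_ge (z s) (d s)
    rw [hf, feedback, inner_neg_left]
    linarith
  rw [intervalIntegral.integral_sub (hdi.const_mul 16) hDi,
    intervalIntegral.integral_const_mul] at hfin
  linarith

/-- Quantitative observability on a window of length one: the dissipated energy controls the
energy, thanks to the Kato smoothing effect. -/
theorem window_le {a r : ℝ} (ha : 0 ≤ a) (hr : ∀ s ∈ Icc a (a + 1), ‖z s‖ ^ 2 ≤ r) (θ : ℝ) :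
    2 * θ * ∫ s in a..(a + 1), ‖z s‖ ^ 2 ≤
      (∫ s in a..(a + 1), inner ℝ (sat L (z s)) (z s)) +
        θ ^ 2 * r * (2 + L / 3 * (r + L * (L + r) + L * r)) := by
  have hab : a ≤ a + 1 := by linarith
  have hr0 : 0 ≤ r := (sq_nonneg _).trans (hr a ⟨le_rfl, hab⟩)
  have hK : ∀ s ∈ Icc a (a + 1), ‖z s‖ ≤ √r := fun s hs => Real.le_sqrt_of_sq_le (hr s hs)
  set f := feedback L d z with hf
  have hzm := h.aestronglyMeasurable
  have hfm := h.aestronglyMeasurable_feedback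
  have hJm : ∀ l, AEStronglyMeasurable (fun s => l • R l (z s)) (volume.restrict (Ioi 0)) :=
    fun l => (l • R l).continuous.comp_aestronglyMeasurable hzm
  have hJfm : ∀ l, AEStronglyMeasurable (fun s => l • R l (f s)) (volume.restrict (Ioi 0)) :=
    fun l => (l • R l).continuous.comp_aestronglyMeasurable hfm
  have hXm : ∀ l, AEStronglyMeasurable (fun s => mulX L (l • R l (z s)))
      (volume.restrict (Ioi 0)) :=
    fun l => (mulX L).continuous.comp_aestronglyMeasurable (hJm l)
  have hSm : ∀ l, AEStronglyMeasurable
      (fun s => inner ℝ (sat L (l • R l (z s))) (l • R l (z s))) (volume.restrict (Ioi 0)) :=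
    fun l => ((lipschitzWith_sat L).continuous.comp_aestronglyMeasurable (hJm l)).inner (hJm l)
  have hNm : ∀ l, AEStronglyMeasurable (fun s => ‖l • R l (z s)‖ ^ 2)
      (volume.restrict (Ioi 0)) := fun l => (hJm l).norm.pow 2
  have hJz : ∀ l, 0 < l → ∀ s ∈ Icc a (a + 1), ‖l • R l (z s)‖ ≤ √r := fun l hl s hs =>
    (hR.norm_smul_le hl _).trans (hK s hs)
  have hJz2 : ∀ l, 0 < l → ∀ s ∈ Icc a (a + 1), ‖l • R l (z s)‖ ^ 2 ≤ r := fun l hl s hs => by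
    have := pow_le_pow_left₀ (norm_nonneg _) (hJz l hl s hs) 2
    rwa [Real.sq_sqrt hr0] at this
  have hJf : ∀ l, 0 < l → ∀ s, ‖l • R l (f s)‖ ≤ √L := fun l hl s =>
    (hR.norm_smul_le hl _).trans (norm_feedback_le hL.le s)
  have hSb : ∀ l, 0 < l → ∀ s ∈ Icc a (a + 1),
      ‖inner ℝ (sat L (l • R l (z s))) (l • R l (z s))‖ ≤ √L * √r := fun l hl s hs =>
    norm_inner_le_of_le (norm_sat_le hL.le _) (hJz l hl s hs)
  have hNb : ∀ l, 0 < l → ∀ s ∈ Icc a (a + 1), ‖‖l • R l (z s)‖ ^ 2‖ ≤ r := fun l hl s hs => by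
    rw [Real.norm_of_nonneg (sq_nonneg _)]
    exact hJz2 l hl s hs
  have hlimN : Tendsto (fun l => ∫ s in a..(a + 1), ‖l • R l (z s)‖ ^ 2) atTop
      (𝓝 (∫ s in a..(a + 1), ‖z s‖ ^ 2)) :=
    tendsto_intervalIntegral_of_bound ha hab hNm hNb fun s _ => (hR.tendsto_smul _).norm.pow 2
  have hlimS : Tendsto
      (fun l => ∫ s in a..(a + 1), inner ℝ (sat L (l • R l (z s))) (l • R l (z s))) atTop
      (𝓝 (∫ s in a..(a + 1), inner ℝ (sat L (z s)) (z s))) :=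
    tendsto_intervalIntegral_of_bound ha hab hSm hSb fun s _ =>
      (((lipschitzWith_sat L).continuous.tendsto _).comp (hR.tendsto_smul _)).inner
        (hR.tendsto_smul _)
  refine le_of_tendsto_of_tendsto (hlimN.const_mul (2 * θ))
    (hlimS.add tendsto_const_nhds) ?_
  filter_upwards [eventually_gt_atTop 0] with l hl
  set y : ℝ → L2 L := fun s => l • R l (z s) with hy
  set w : ℝ → L2 L := fun s => yosida R l (z s) with hw
  have hA : ∀ s, KdVOperator L (y s) (w s) := fun s => hR.smul_mem_graph hl (z s)
  have hwm : AEStronglyMeasurable w (volume.restrict (Ioi 0)) :=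
    (yosida R l).continuous.comp_aestronglyMeasurable hzm
  have hyX : ∀ s ∈ Icc a (a + 1), ‖mulX L (y s)‖ ≤ L * √r := fun s hs =>
    (norm_mulX_le _).trans (mul_le_mul_of_nonneg_left (hJz l hl s hs) hL.le)
  set G : ℝ → ℝ := fun s => ‖y s‖ ^ 2 - 2 * inner ℝ (w s) (mulX L (y s)) with hG
  have hiN : IntervalIntegrable (fun s => ‖y s‖ ^ 2) volume a (a + 1) :=
    intervalIntegrable_of_bound_on ha hab (hNm l) (hNb l hl)
  have hiW : IntervalIntegrable (fun s => inner ℝ (w s) (mulX L (y s))) volume a (a + 1) :=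
    intervalIntegrable_of_bound_on ha hab (hwm.inner (hXm l)) fun s hs =>
      norm_inner_le_of_le ((yosida R l).le_opNorm_of_le (hK s hs)) (hyX s hs)
  have hiF : IntervalIntegrable (fun s => inner ℝ (l • R l (f s)) (mulX L (y s)))
      volume a (a + 1) :=
    intervalIntegrable_of_bound_on ha hab ((hJfm l).inner (hXm l)) fun s hs =>
      norm_inner_le_of_le (hJf l hl s) (hyX s hs)
  have hiG : IntervalIntegrable G volume a (a + 1) := hiN.sub (hiW.const_mul 2)
  have hiS : IntervalIntegrable (fun s => inner ℝ (sat L (y s)) (y s)) volume a (a + 1) :=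
    intervalIntegrable_of_bound_on ha hab (hSm l) (hSb l hl)
  -- Smoothing, uniformly in `l`: adding the integrand of the identity for the weight `x` to `G`
  -- cancels the unbounded term `w`. What remains is at most `r + L (L + r)`, and the weighted
  -- energy drops by at most `L r`.
  have hGint : ∫ s in a..(a + 1), G s ≤ r + L * (L + r) + L * r := by
    have e := regularized_identity hL hR hT h mulX_symm hl ha hab
    have h1 : ∫ s in a..(a + 1), (G s + 2 * inner ℝ (w s + l • R l (f s)) (mulX L (y s))) ≤
        ∫ _ in a..(a + 1), (r + L * (L + r)) := by
      refine intervalIntegral.integral_mono_on hab (hiG.add ?_) intervalIntegrable_const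
        fun s hs => ?_
      · simp only [inner_add_left]
        exact (hiW.add hiF).const_mul 2
      · rw [hG, inner_add_left]
        have h2 := real_inner_le_norm (l • R l (f s)) (mulX L (y s))
        have h3 : ‖l • R l (f s)‖ * ‖mulX L (y s)‖ ≤ ‖l • R l (f s)‖ * (L * ‖y s‖) :=
          mul_le_mul_of_nonneg_left (norm_mulX_le _) (norm_nonneg _)
        have h4 : ‖l • R l (f s)‖ ^ 2 ≤ L :=
          (pow_le_pow_left₀ (norm_nonneg _) (hR.norm_smul_le hl _) 2).trans
            (norm_feedback_sq_le hL.le s)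
        have h5 := hJz2 l hl s hs
        have h6 : 2 * (‖l • R l (f s)‖ * (L * ‖y s‖)) ≤ L * (L + r) := by
          have : 2 * (‖l • R l (f s)‖ * ‖y s‖) ≤ L + r := by
            nlinarith [sq_nonneg (‖l • R l (f s)‖ - ‖y s‖)]
          calc 2 * (‖l • R l (f s)‖ * (L * ‖y s‖)) = L * (2 * (‖l • R l (f s)‖ * ‖y s‖)) := by
                ring
            _ ≤ _ := by gcongr
        linarith
    rw [intervalIntegral.integral_add hiG (by
        simp only [inner_add_left]
        exact (hiW.add hiF).const_mul 2), ← e, intervalIntegral.integral_const] at h1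
    have h7 := inner_mulX_nonneg (y (a + 1))
    have h8 : inner ℝ (y a) (mulX L (y a)) ≤ L * r := by
      have m : a ∈ Icc a (a + 1) := ⟨le_rfl, hab⟩
      have h9 := hJz2 l hl a m
      refine (real_inner_le_norm _ _).trans ((mul_le_mul_of_nonneg_left (norm_mulX_le _)
        (norm_nonneg _)).trans ?_)
      calc ‖y a‖ * (L * ‖y a‖) = L * ‖y a‖ ^ 2 := by ring
        _ ≤ L * r := by gcongr
    simp only [add_sub_cancel_left, one_smul] at h1
    linarith
  have hpt : ∀ s ∈ Icc a (a + 1), 2 * θ * ‖y s‖ ^ 2 ≤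
      inner ℝ (sat L (y s)) (y s) + θ ^ 2 * r * (2 + L / 3 * G s) := by
    intro s hs
    have h1 := norm_sq_le_mul_inner_sat ((hA s).sq_le hL)
    have h2 := (hA s).nonneg hL
    have h3 := hJz2 l hl s hs
    have h4 := inner_sat_nonneg (y s)
    change ‖y s‖ ^ 2 ≤ (2 + L / 3 * G s) * _ at h1
    change 0 ≤ G s at h2
    change ‖y s‖ ^ 2 ≤ r at h3
    set X := 2 + L / 3 * G s with hX
    have hX0 : 0 < X := by positivity
    set D := inner ℝ (sat L (y s)) (y s)
    -- From `‖y‖² ≤ X D` and `(θ X - 1)² ≥ 0`. The right side is linear in `X`, so the time integral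
    -- of `X` suffices, although `X` has no pointwise bound uniform in `l`.
    have h5 : 2 * θ * ‖y s‖ ^ 2 ≤ D + θ ^ 2 * ‖y s‖ ^ 2 * X := by
      refine le_of_mul_le_mul_left ?_ hX0
      nlinarith [mul_nonneg (sq_nonneg ‖y s‖) (sq_nonneg (θ * X - 1))]
    have h6 : θ ^ 2 * ‖y s‖ ^ 2 * X ≤ θ ^ 2 * r * X := by gcongr
    linarith
  have hmono := intervalIntegral.integral_mono_on hab (hiN.const_mul (2 * θ))
    (hiS.add ((intervalIntegrable_const.add (hiG.const_mul (L / 3))).const_mul (θ ^ 2 * r))) hpt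
  rw [intervalIntegral.integral_const_mul, intervalIntegral.integral_add hiS
    ((intervalIntegrable_const.add (hiG.const_mul (L / 3))).const_mul (θ ^ 2 * r)),
    intervalIntegral.integral_const_mul, intervalIntegral.integral_add intervalIntegrable_const
    (hiG.const_mul (L / 3)), intervalIntegral.integral_const_mul,
    intervalIntegral.integral_const] at hmono
  refine hmono.trans ?_
  simp only [add_sub_cancel_left, one_smul]
  gcongr

theorem norm_sq_le {t : ℝ} (ht : 0 ≤ t) : ‖z t‖ ^ 2 ≤ ‖z₀‖ ^ 2 + 16 * ‖d‖ ^ 2 := by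
  have h1 := energy_le hL hR hT h le_rfl ht
  have h2 : 0 ≤ ∫ s in (0 : ℝ)..t, inner ℝ (sat L (z s)) (z s) :=
    intervalIntegral.integral_nonneg ht fun s _ => inner_sat_nonneg _
  have h3 := integral_norm_sq_le d ht
  rw [h.apply_zero (hR.limit_isContractionSemigroup hT)] at h1
  linarith

/-- Take `θ = 1 / Q` in the window estimate. Up to `16 δ`, the energy on the window lies between its
final and initial values, so `(1 + 2 / Q) ‖z (a + 1)‖² ≤ (1 + 1 / Q) ‖z a‖²` modulo `δ`. -/
theorem step_le {a r : ℝ} (ha : 0 ≤ a) (hr : ∀ t, 0 ≤ t → ‖z t‖ ^ 2 ≤ r)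
    {Q : ℝ} (hQ : Q = 2 + L / 3 * (r + L * (L + r) + L * r)) :
    ‖z (a + 1)‖ ^ 2 ≤ (Q + 1) / (Q + 2) * ‖z a‖ ^ 2 + 32 * ∫ s in a..(a + 1), ‖d s‖ ^ 2 := by
  have hab : a ≤ a + 1 := by linarith
  have hr0 : 0 ≤ r := (sq_nonneg _).trans (hr a ha)
  have hQ0 : 0 < Q := by rw [hQ]; positivity
  set δ := ∫ s in a..(a + 1), ‖d s‖ ^ 2 with hδ
  have hδ0 : 0 ≤ δ := intervalIntegral.integral_nonneg hab fun s _ => sq_nonneg _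
  have hD0 : ∀ b c, b ≤ c → 0 ≤ ∫ s in b..c, inner ℝ (sat L (z s)) (z s) := fun b c hbc =>
    intervalIntegral.integral_nonneg hbc fun s _ => inner_sat_nonneg _
  have hsub : ∀ b c, a ≤ b → b ≤ c → c ≤ a + 1 → ∫ s in b..c, ‖d s‖ ^ 2 ≤ δ :=
    fun b c hab' hbc hc => intervalIntegral.integral_mono_interval hab' hbc hc
      (ae_of_all _ fun s => sq_nonneg _) (intervalIntegrable_norm_sq d ha hab)
  -- The bound `r` keeps the smoothing factor below `Q`; the local bound makes the remainder
  -- proportional to the initial energy of the window.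
  have hup : ∀ s ∈ Icc a (a + 1), ‖z s‖ ^ 2 ≤ min r (‖z a‖ ^ 2 + 16 * δ) := fun s hs => by
    have h1 := energy_le hL hR hT h ha hs.1
    have h2 := hD0 a s hs.1
    have h3 := hsub a s le_rfl hs.1 hs.2
    exact le_min (hr s (ha.trans hs.1)) (by linarith)
  set ρ := min r (‖z a‖ ^ 2 + 16 * δ) with hρ
  have hρ0 : 0 ≤ ρ := le_min hr0 (by positivity)
  have hw := window_le hL hR hT h ha hup (1 / Q)
  have hlow : ‖z (a + 1)‖ ^ 2 - 16 * δ ≤ ∫ s in a..(a + 1), ‖z s‖ ^ 2 := by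
    have hc : ∫ _ in a..(a + 1), (‖z (a + 1)‖ ^ 2 - 16 * δ) = ‖z (a + 1)‖ ^ 2 - 16 * δ := by
      rw [intervalIntegral.integral_const]
      simp
    rw [← hc]
    refine intervalIntegral.integral_mono_on hab intervalIntegrable_const ?_ fun s hs => ?_
    · refine ContinuousOn.intervalIntegrable ?_
      rw [uIcc_of_le hab]
      exact (h.continuousOn.mono fun s hs => ha.trans hs.1).norm.pow 2
    · have h1 := energy_le hL hR hT h (ha.trans hs.1) hs.2
      have h2 := hD0 s (a + 1) hs.2
      have h3 := hsub s (a + 1) hs.1 hs.2 le_rfl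
      linarith
  have hE := energy_le hL hR hT h ha hab
  have hQρ : (1 / Q) ^ 2 * ρ * (2 + L / 3 * (ρ + L * (L + ρ) + L * ρ)) ≤
      1 / Q * (‖z a‖ ^ 2 + 16 * δ) := by
    have h1 : 2 + L / 3 * (ρ + L * (L + ρ) + L * ρ) ≤ Q := by
      have : ρ ≤ r := min_le_left _ _
      rw [hQ]
      gcongr
    have h2 : ρ ≤ ‖z a‖ ^ 2 + 16 * δ := min_le_right _ _
    calc (1 / Q) ^ 2 * ρ * (2 + L / 3 * (ρ + L * (L + ρ) + L * ρ)) ≤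
          (1 / Q) ^ 2 * (‖z a‖ ^ 2 + 16 * δ) * Q := by gcongr
      _ = _ := by field_simp
  have hlow' : 2 * (1 / Q) * (‖z (a + 1)‖ ^ 2 - 16 * δ) ≤
      2 * (1 / Q) * ∫ s in a..(a + 1), ‖z s‖ ^ 2 := by gcongr
  have hmain : ‖z (a + 1)‖ ^ 2 + 2 * (1 / Q) * (‖z (a + 1)‖ ^ 2 - 16 * δ) ≤
      ‖z a‖ ^ 2 + 16 * δ + 1 / Q * (‖z a‖ ^ 2 + 16 * δ) := by linarith
  have hmul := mul_le_mul_of_nonneg_left hmain hQ0.le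
  have e : Q * (‖z (a + 1)‖ ^ 2 + 2 * (1 / Q) * (‖z (a + 1)‖ ^ 2 - 16 * δ)) =
      (Q + 2) * ‖z (a + 1)‖ ^ 2 - 32 * δ := by
    field_simp
    ring
  have e' : Q * (‖z a‖ ^ 2 + 16 * δ + 1 / Q * (‖z a‖ ^ 2 + 16 * δ)) =
      (Q + 1) * ‖z a‖ ^ 2 + 16 * (Q + 1) * δ := by
    field_simp
  rw [e, e'] at hmul
  rw [div_mul_eq_mul_div, ← sub_le_iff_le_add, le_div_iff₀ (by linarith)]
  nlinarith

/-- Iterate over `⌊t⌋` windows with `(Q + 1) / (Q + 2) ≤ exp (-1 / (Q + 2))`. The incomplete last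
window costs a factor `e < 4`, and the disturbance contributes `32` on full windows plus `16` on the
rest, at most `48`. -/
theorem decay_le {r : ℝ} (hr : ∀ t, 0 ≤ t → ‖z t‖ ^ 2 ≤ r)
    {Q : ℝ} (hQ : Q = 2 + L / 3 * (r + L * (L + r) + L * r)) {t : ℝ} (ht : 0 ≤ t) :
    ‖z t‖ ^ 2 ≤ 4 * Real.exp (-(t / (Q + 2))) * ‖z₀‖ ^ 2 + 48 * ‖d‖ ^ 2 := by
  have hr0 : 0 ≤ r := (sq_nonneg _).trans (hr 0 le_rfl)
  have hQ0 : 0 < Q := by rw [hQ]; positivity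
  set q := (Q + 1) / (Q + 2) with hq
  have hq0 : 0 ≤ q := by positivity
  have hq1 : q ≤ 1 := by
    rw [hq, div_le_one (by positivity)]
    linarith
  have hz0 := h.apply_zero (hR.limit_isContractionSemigroup hT)
  have hind : ∀ n : ℕ, ‖z n‖ ^ 2 ≤ q ^ n * ‖z₀‖ ^ 2 + 32 * ∫ s in (0 : ℝ)..n, ‖d s‖ ^ 2 := by
    intro n
    induction n with
    | zero => simp [hz0]
    | succ n ih =>
      have h1 := step_le hL hR hT h (Nat.cast_nonneg n) hr hQ
      rw [← hq] at h1
      have h2 := intervalIntegral.integral_add_adjacent_intervals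
        (intervalIntegrable_norm_sq d le_rfl (Nat.cast_nonneg n))
        (intervalIntegrable_norm_sq d (Nat.cast_nonneg n) (by linarith : (n : ℝ) ≤ n + 1))
      have h3 : 0 ≤ ∫ s in (0 : ℝ)..n, ‖d s‖ ^ 2 :=
        intervalIntegral.integral_nonneg (Nat.cast_nonneg n) fun s _ => sq_nonneg _
      push_cast
      rw [← h2, pow_succ q n]
      have h4 := mul_le_mul_of_nonneg_left ih hq0
      have h5 := mul_le_mul_of_nonneg_right hq1 h3
      linarith
  set n := ⌊t⌋₊ with hn
  have hnt : (n : ℝ) ≤ t := Nat.floor_le ht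
  have hnt' : t < n + 1 := Nat.lt_floor_add_one t
  have h1 := energy_le hL hR hT h (Nat.cast_nonneg n) hnt
  have h2 : 0 ≤ ∫ s in (n : ℝ)..t, inner ℝ (sat L (z s)) (z s) :=
    intervalIntegral.integral_nonneg hnt fun s _ => inner_sat_nonneg _
  have h3 := hind n
  have h4 := intervalIntegral.integral_add_adjacent_intervals
    (intervalIntegrable_norm_sq d le_rfl (Nat.cast_nonneg n))
    (intervalIntegrable_norm_sq d (Nat.cast_nonneg n) hnt)
  have h5 := integral_norm_sq_le d ht
  have h6 : 0 ≤ ∫ s in (0 : ℝ)..n, ‖d s‖ ^ 2 :=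
    intervalIntegral.integral_nonneg (Nat.cast_nonneg n) fun s _ => sq_nonneg _
  have h7 : 0 ≤ ∫ s in (n : ℝ)..t, ‖d s‖ ^ 2 :=
    intervalIntegral.integral_nonneg hnt fun s _ => sq_nonneg _
  have h8 : q ^ n ≤ 4 * Real.exp (-(t / (Q + 2))) := by
    have e1 : q = 1 - 1 / (Q + 2) := by
      rw [hq]
      field_simp
      ring
    have h9 : q ≤ Real.exp (-(1 / (Q + 2))) := by
      rw [e1]
      linarith [Real.add_one_le_exp (-(1 / (Q + 2)))]
    have h10 : q ^ n ≤ Real.exp (n * -(1 / (Q + 2))) := by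
      rw [Real.exp_nat_mul]
      exact pow_le_pow_left₀ hq0 h9 n
    have h11 : (n : ℝ) * -(1 / (Q + 2)) ≤ 1 + -(t / (Q + 2)) := by
      have : (t - n) / (Q + 2) ≤ 1 := by
        rw [div_le_one (by positivity)]
        linarith
      have e2 : (t - n) / (Q + 2) = t / (Q + 2) + n * -(1 / (Q + 2)) := by ring
      linarith
    refine h10.trans ((Real.exp_le_exp.2 h11).trans ?_)
    rw [Real.exp_add]
    have := Real.exp_one_lt_three
    gcongr
    linarith
  have h12 := mul_le_mul_of_nonneg_right h8 (sq_nonneg ‖z₀‖)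
  linarith

end

theorem isISS (hL : 0 < L) (hR : IsResolventOf (KdVOperator L) R)
    (hT : ∀ t, 0 ≤ t → ∀ x, Tendsto (fun l => yosidaExp R l t x) atTop (𝓝 (T t x))) :
    IsISS T (sat L) := by
  -- Chosen so that `Q + 2 ≤ c (1 + ‖z₀‖²)` when `‖d‖ ≤ ‖z₀‖`, where `17 = 1 + 16`. Taking square
  -- roots in the decay estimate gives the factor `2 = √4` and the rate `1 / (2 c)`; the gain `7`
  -- works as `48 ≤ 7²`.
  set c : ℝ := 4 + L / 3 * L ^ 2 + L / 3 * (1 + 2 * L) * 17 with hc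
  have hc0 : 0 < c := by positivity
  refine ⟨fun r t => 2 * r * Real.exp (-(1 / (2 * c) * t / (1 + r ^ 2))), fun s => 7 * s,
    isClassKL_exp two_pos (by positivity), isClassKInfty_const_mul (by norm_num), ?_⟩
  intro z₀ d z h t ht
  have hbd : ∀ t, 0 ≤ t → ‖z t‖ ^ 2 ≤ ‖z₀‖ ^ 2 + 16 * ‖d‖ ^ 2 := fun t ht =>
    norm_sq_le hL hR hT h ht
  set r := ‖z₀‖ with hr
  have hr0 : 0 ≤ r := norm_nonneg _
  have hd0 : 0 ≤ ‖d‖ := norm_nonneg _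
  set E := Real.exp (-(1 / (2 * c) * t / (1 + r ^ 2))) with hE
  have hE0 : 0 < E := Real.exp_pos _
  simp only
  rcases le_total ‖d‖ r with hcase | hcase
  · have h1 := decay_le hL hR hT h hbd rfl ht
    set ρ := r ^ 2 + 16 * ‖d‖ ^ 2 with hρ
    have hρ0 : 0 ≤ ρ := by positivity
    have hρle : ρ ≤ 17 * r ^ 2 := by
      have := pow_le_pow_left₀ hd0 hcase 2
      linarith
    have hQ : 2 + L / 3 * (ρ + L * (L + ρ) + L * ρ) + 2 ≤ c * (1 + r ^ 2) := by
      have e1 : 2 + L / 3 * (ρ + L * (L + ρ) + L * ρ) + 2 =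
          4 + L / 3 * L ^ 2 + L / 3 * (1 + 2 * L) * ρ := by ring
      have h2 : L / 3 * (1 + 2 * L) * ρ ≤ L / 3 * (1 + 2 * L) * (17 * r ^ 2) := by gcongr
      have h3 : 0 ≤ (4 + L / 3 * L ^ 2) * r ^ 2 := by positivity
      have h4 : 0 ≤ L / 3 * (1 + 2 * L) * 17 := by positivity
      rw [e1, hc]
      linarith
    have hexp : Real.exp (-(t / (2 + L / 3 * (ρ + L * (L + ρ) + L * ρ) + 2))) ≤ E ^ 2 := by
      rw [hE, ← Real.exp_nat_mul]
      refine Real.exp_le_exp.2 ?_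
      have h5 : t / (c * (1 + r ^ 2)) ≤ t / (2 + L / 3 * (ρ + L * (L + ρ) + L * ρ) + 2) := by
        gcongr
      have e2 : ((2 : ℕ) : ℝ) * -(1 / (2 * c) * t / (1 + r ^ 2)) = -(t / (c * (1 + r ^ 2))) := by
        push_cast
        field_simp
      rw [e2]
      linarith
    have h6 : ‖z t‖ ^ 2 ≤ (2 * r * E + 7 * ‖d‖) ^ 2 := by
      have h7 := mul_le_mul_of_nonneg_right hexp (sq_nonneg r)
      have h8 : 0 ≤ r * E * ‖d‖ := by positivity
      nlinarith [sq_nonneg ‖d‖]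
    exact (sq_le_sq₀ (norm_nonneg _) (by positivity)).1 h6
  -- When the disturbance dominates, decay is not needed: `‖z t‖² ≤ 17 ‖d‖² ≤ 49 ‖d‖²`.
  · have h1 := hbd t ht
    have h2 := pow_le_pow_left₀ hr0 hcase 2
    have h3 : ‖z t‖ ≤ 7 * ‖d‖ := by
      refine (sq_le_sq₀ (norm_nonneg _) (by positivity)).1 ?_
      nlinarith [sq_nonneg ‖d‖]
    have h4 : 0 ≤ 2 * r * E := by positivity
    linarith

end Estimates

end KdVISS

open KdVISS
theorem mainTheorem4 (L : ℝ) (hL : 0 < L) :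
    ∃ T : ℝ → L2 L →L[ℝ] L2 L,
      IsContractionSemigroup T ∧ IsGeneratorOf (KdVOperator L) T ∧
      (∀ (z₀ : L2 L) (d : Disturbance (L2 L)), ∃ z : ℝ → L2 L,
        IsWeakSolution T (sat L) d z₀ z) ∧
      IsISS T (sat L) := by
  obtain ⟨R, hR⟩ := KdVOperator.exists_resolvent hL
  obtain ⟨T, hT⟩ := hR.exists_semigroup
  have hTc := hR.limit_isContractionSemigroup hT
  exact ⟨T, hTc, hR.limit_isGeneratorOf hT,
    fun z₀ d => exists_isWeakSolution hTc (lipschitzWith_sat L) (norm_sat_le hL.le) d z₀,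
    isISS hL hR hT⟩
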